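/- Let $(\overline{M},\overline{g})$ be a smooth Riemannian manifold with Levi-Civita connection $\overline{\nabla}$, let $p,q\ge 1$ be integers, and let $J$ be a smooth $(1,1)$-tensor field on $\overline{M}$ with $J^2=pJ+qI$, $\overline{g}(JX,Y)=\overline{g}(X,JY)$ for all vector fields $X,Y$, and $\overline{\nabla}J=0$; that is, $(\overline{M},\overline{g},J)$ is a locally metallic Riemannian manifold (locally Golden if $p=q=1$). Let $M$ be a submanifold isometrically immersed in $\overline{M}$, with Levi-Civita connection $\nabla$. For $X,Y\in\Gamma(TM)$ and $V\in\Gamma(T^{\perp}M)$ let $TX=(JX)^{T}$, $NX=(JX)^{\perp}$ and $nV=(JV)^{\perp}$ be the tangential and normal parts, let $A_VX=-(\overline{\nabla}_XV)^{T}$ be the shape operator and $\nabla^{\perp}_XV=(\overline{\nabla}_XV)^{\perp}$ the normal connection, and put $(\overline{\nabla}_XN)Y=\nabla^{\perp}_X(NY)-N(\nabla_XY)$; $N$ is called parallel if $(\overline{\nabla}_XN)Y=0$ for all $X,Y\in\Gamma(TM)$. Suppose that $M$ is a semi-slant submanifold, i.e. there are smooth distributions $D_1,D_2$ on $M$ with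 $TM=D_1\oplus D_2$ an orthogonal direct sum, $J(D_1)=D_1$, and such that for some constant $\theta\neq 0$ the angle between $Ju$ and the subspace $(D_2)_x$ equals $\theta$ for all $x\in M$ and all nonzero $u\in (D_2)_x$. Then $N$ is parallel if and only if $$A_{nV}X=TA_VX=A_VTX\qquad\text{for all } X\in\Gamma(TM),\ V\in\Gamma(T^{\perp}M).$$ -/

import Mathlib

open Bundle VectorField
open scoped Manifold ContDiff

set_option linter.unusedSectionVars false

noncomputable section

namespace MetallicGeometry

/-! ### The Levi-Civita connection of a Riemannian manifold -/

section LeviCivita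

variable {E : Type*} [NormedAddCommGroup E] [NormedSpace ℝ E]
  {H : Type*} [TopologicalSpace H] (I : ModelWithCorners ℝ E H)
  {M : Type*} [TopologicalSpace M] [ChartedSpace H M]

instance finiteDimensional_tangentSpace [FiniteDimensional ℝ E] (x : M) :
    FiniteDimensional ℝ (TangentSpace I x) :=
  inferInstanceAs (FiniteDimensional ℝ E)

variable [IsManifold I ∞ M] [RiemannianBundle (fun x : M => TangentSpace I x)]

/-- The right hand side of Koszul's formula for `2 ⟪∇_X Y, Z⟫`. -/
def koszul (X Y Z : Π x : M, TangentSpace I x) (x : M) : ℝ :=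
  d% (fun y => inner ℝ (Y y) (Z y)) x (X x)
    + d% (fun y => inner ℝ (X y) (Z y)) x (Y x)
    - d% (fun y => inner ℝ (X y) (Y y)) x (Z x)
    + inner ℝ (mlieBracket I X Y x) (Z x)
    - inner ℝ (mlieBracket I X Z x) (Y x)
    - inner ℝ (mlieBracket I Y Z x) (X x)

variable [IsContMDiffRiemannianBundle I ∞ E (fun x : M => TangentSpace I x)]

theorem mdifferentiableAt_inner {x : M} {X Y : Π x : M, TangentSpace I x}
    (hX : MDiffAt (T% X) x) (hY : MDiffAt (T% Y) x) :
    MDiffAt (fun y => inner ℝ (X y) (Y y)) x :=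
  MDifferentiableAt.inner_bundle (IB := I) (F := E) (E := fun x : M => TangentSpace I x)
    (b := fun y => y) hX hY

variable [FiniteDimensional ℝ E]

theorem koszul_tensorial_left {x : M} {Y Z : Π x : M, TangentSpace I x}
    (hY : MDiffAt (T% Y) x) (hZ : MDiffAt (T% Z) x) :
    TensorialAt I E (fun X => koszul I X Y Z x) x where
  smul {f X} hf hX := by
    have : CompleteSpace E := FiniteDimensional.complete ℝ E
    simp [koszul, mlieBracket_smul_left hf hX, inner_smul_left, inner_smul_right, inner_add_left,
      mvfderiv_fun_mul hf (mdifferentiableAt_inner I hX hZ),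
      mvfderiv_fun_mul hf (mdifferentiableAt_inner I hX hY)]
    rw [real_inner_comm (Z x) (X x), real_inner_comm (Y x) (X x)]
    ring
  add {X X'} hX hX' := by
    have : CompleteSpace E := FiniteDimensional.complete ℝ E
    simp [koszul, mlieBracket_add_left hX hX', inner_add_left, inner_add_right,
      mvfderiv_fun_add (mdifferentiableAt_inner I hX hZ) (mdifferentiableAt_inner I hX' hZ),
      mvfderiv_fun_add (mdifferentiableAt_inner I hX hY) (mdifferentiableAt_inner I hX' hY)]
    ring

theorem koszul_tensorial_right {x : M} {X Y : Π x : M, TangentSpace I x}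
    (hX : MDiffAt (T% X) x) (hY : MDiffAt (T% Y) x) :
    TensorialAt I E (fun Z => koszul I X Y Z x) x where
  smul {f Z} hf hZ := by
    have : CompleteSpace E := FiniteDimensional.complete ℝ E
    simp [koszul, mlieBracket_smul_right hf hZ, inner_smul_left, inner_smul_right, inner_add_left,
      mvfderiv_fun_mul hf (mdifferentiableAt_inner I hX hZ),
      mvfderiv_fun_mul hf (mdifferentiableAt_inner I hY hZ)]
    rw [real_inner_comm (X x) (Z x), real_inner_comm (Y x) (Z x)]
    ring
  add {Z Z'} hZ hZ' := by
    have : CompleteSpace E := FiniteDimensional.complete ℝ E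
    simp [koszul, mlieBracket_add_right hZ hZ', inner_add_left, inner_add_right,
      mvfderiv_fun_add (mdifferentiableAt_inner I hX hZ) (mdifferentiableAt_inner I hX hZ'),
      mvfderiv_fun_add (mdifferentiableAt_inner I hY hZ) (mdifferentiableAt_inner I hY hZ')]
    ring

theorem koszul_add_middle {x : M} {X Y Y' Z : Π x : M, TangentSpace I x}
    (hX : MDiffAt (T% X) x) (hY : MDiffAt (T% Y) x) (hY' : MDiffAt (T% Y') x)
    (hZ : MDiffAt (T% Z) x) :
    koszul I X (Y + Y') Z x = koszul I X Y Z x + koszul I X Y' Z x := by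
  have : CompleteSpace E := FiniteDimensional.complete ℝ E
  simp [koszul, mlieBracket_add_right hY hY', mlieBracket_add_left hY hY',
    inner_add_left, inner_add_right,
    mvfderiv_fun_add (mdifferentiableAt_inner I hY hZ) (mdifferentiableAt_inner I hY' hZ),
    mvfderiv_fun_add (mdifferentiableAt_inner I hX hY) (mdifferentiableAt_inner I hX hY')]
  ring

theorem koszul_smul_middle {x : M} {f : M → ℝ} {X Y Z : Π x : M, TangentSpace I x}
    (hf : MDiffAt f x) (hX : MDiffAt (T% X) x) (hY : MDiffAt (T% Y) x) (hZ : MDiffAt (T% Z) x) :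
    koszul I X (f • Y) Z x
      = f x * koszul I X Y Z x + 2 * (d% f x (X x) * inner ℝ (Y x) (Z x)) := by
  have : CompleteSpace E := FiniteDimensional.complete ℝ E
  simp [koszul, mlieBracket_smul_right hf hY, mlieBracket_smul_left hf hY,
    inner_smul_left, inner_smul_right, inner_add_left,
    mvfderiv_fun_mul hf (mdifferentiableAt_inner I hY hZ),
    mvfderiv_fun_mul hf (mdifferentiableAt_inner I hX hY)]
  rw [real_inner_comm (X x) (Y x)]
  ring

open Classical in
/-- The bilinear form `(u, w) ↦ 2 ⟪∇_u Y, w⟫` on `T_x M` given by Koszul's formula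
(and zero when `Y` is not differentiable at `x`). -/
def koszulForm (Y : Π x : M, TangentSpace I x) (x : M) :
    TangentSpace I x →L[ℝ] TangentSpace I x →L[ℝ] ℝ :=
  if hY : MDiffAt (T% Y) x then
    TensorialAt.mkHom₂ (I := I) (F := E) (F' := E) (fun X Z => koszul I X Y Z x) x
      (fun _ hZ => koszul_tensorial_left I hY hZ) (fun _ hX => koszul_tensorial_right I hX hY)
  else 0

theorem koszulForm_apply {x : M} {X Y Z : Π x : M, TangentSpace I x}
    (hX : MDiffAt (T% X) x) (hY : MDiffAt (T% Y) x) (hZ : MDiffAt (T% Z) x) :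
    koszulForm I Y x (X x) (Z x) = koszul I X Y Z x := by
  rw [koszulForm, dif_pos hY]
  exact TensorialAt.mkHom₂_apply (I := I) (F := E) (F' := E) _ _ hX hZ

/-- `∇_u Y`, the vector which represents the linear form `w ↦ koszulForm Y x u w / 2`. -/
def leviCivitaFun (Y : Π x : M, TangentSpace I x) (x : M) :
    TangentSpace I x →L[ℝ] TangentSpace I x :=
  LinearMap.toContinuousLinearMap
    { toFun := fun u => (1 / 2 : ℝ) •
        (InnerProductSpace.toDual ℝ (TangentSpace I x)).symm (koszulForm I Y x u)
      map_add' := by intro u v; simp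
      map_smul' := by intro c u; simp [smul_comm c] }

theorem inner_leviCivitaFun (Y : Π x : M, TangentSpace I x) (x : M) (u w : TangentSpace I x) :
    inner ℝ (leviCivitaFun I Y x u) w = (1 / 2) * koszulForm I Y x u w := by
  simp [leviCivitaFun, inner_smul_left]

theorem ext_koszul {x : M} {L L' : TangentSpace I x →L[ℝ] TangentSpace I x}
    (h : ∀ X Z : Π x : M, TangentSpace I x, MDiffAt (T% X) x → MDiffAt (T% Z) x →
      inner ℝ (L (X x)) (Z x) = inner ℝ (L' (X x)) (Z x)) : L = L' := by
  ext u
  refine ext_inner_right ℝ fun w => ?_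
  have := h (FiberBundle.extend E u) (FiberBundle.extend E w)
    (FiberBundle.mdifferentiableAt_extend ..) (FiberBundle.mdifferentiableAt_extend ..)
  simpa using this

/-- The Levi-Civita connection of a Riemannian manifold, constructed from Koszul's formula, in Mathlib's argument order:
`leviCivita I Y x u` is `∇_u Y` at the point `x`. -/
def leviCivita : CovariantDerivative I E (fun x : M => TangentSpace I x) where
  toFun := leviCivitaFun I
  isCovariantDerivativeOnUniv :=
    { add := by
        intro Y Y' x hY hY' _
        refine ext_koszul I fun X Z hX hZ => ?_
        have hYY' : MDiffAt (T% (Y + Y')) x := mdifferentiableAt_add_section hY hY'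
        simp only [add_apply, inner_add_left, inner_leviCivitaFun,
          koszulForm_apply I hX hYY' hZ, koszulForm_apply I hX hY hZ, koszulForm_apply I hX hY' hZ,
          koszul_add_middle I hX hY hY' hZ]
        ring
      leibniz := by
        intro Y f x hY hf _
        refine ext_koszul I fun X Z hX hZ => ?_
        have hfY : MDiffAt (T% (f • Y)) x := hf.smul_section hY
        simp only [add_apply, smul_apply,
          ContinuousLinearMap.smulRight_apply, inner_add_left, inner_smul_left, inner_leviCivitaFun,
          koszulForm_apply I hX hfY hZ, koszulForm_apply I hX hY hZ,
          koszul_smul_middle I hf hX hY hZ]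
        simp
        ring }

theorem inner_leviCivita {x : M} {X Y Z : Π x : M, TangentSpace I x}
    (hX : MDiffAt (T% X) x) (hY : MDiffAt (T% Y) x) (hZ : MDiffAt (T% Z) x) :
    inner ℝ (leviCivita I Y x (X x)) (Z x) = (1 / 2) * koszul I X Y Z x := by
  rw [← koszulForm_apply I hX hY hZ]
  exact inner_leviCivitaFun I Y x (X x) (Z x)

/-- The Levi-Civita connection is compatible with the metric. -/
theorem leviCivita_metric {x : M} {X Y Z : Π x : M, TangentSpace I x}
    (hX : MDiffAt (T% X) x) (hY : MDiffAt (T% Y) x) (hZ : MDiffAt (T% Z) x) :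
    d% (fun y => inner ℝ (Y y) (Z y)) x (X x)
      = inner ℝ (leviCivita I Y x (X x)) (Z x) + inner ℝ (Y x) (leviCivita I Z x (X x)) := by
  rw [real_inner_comm _ (Y x), inner_leviCivita I hX hY hZ, inner_leviCivita I hX hZ hY]
  have hXY : (fun y => inner ℝ (Z y) (Y y)) = fun y => inner ℝ (Y y) (Z y) :=
    funext fun y => real_inner_comm _ _
  simp only [koszul]
  rw [mlieBracket_swap_apply (V := Z) (W := Y), hXY, inner_neg_left]
  ring

/-- The Levi-Civita connection is torsion free. -/
theorem leviCivita_torsion_free {x : M} {X Y : Π x : M, TangentSpace I x}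
    (hX : MDiffAt (T% X) x) (hY : MDiffAt (T% Y) x) :
    leviCivita I Y x (X x) - leviCivita I X x (Y x) = mlieBracket I X Y x := by
  refine ext_inner_right ℝ fun w => ?_
  obtain ⟨Z, hZ, rfl⟩ : ∃ Z : Π x : M, TangentSpace I x, MDiffAt (T% Z) x ∧ Z x = w :=
    ⟨FiberBundle.extend E w, FiberBundle.mdifferentiableAt_extend .., by simp⟩
  rw [inner_sub_left, inner_leviCivita I hX hY hZ, inner_leviCivita I hY hX hZ]
  have hXY : (fun y => inner ℝ (Y y) (X y)) = fun y => inner ℝ (X y) (Y y) :=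
    funext fun y => real_inner_comm _ _
  simp only [koszul]
  rw [mlieBracket_swap_apply (V := Y) (W := X), hXY, inner_neg_left]
  ring

end LeviCivita

/-! ### Metallic Riemannian manifolds -/

section Ambient

variable {E : Type*} [NormedAddCommGroup E] [NormedSpace ℝ E] [FiniteDimensional ℝ E]
  {H : Type*} [TopologicalSpace H] (I : ModelWithCorners ℝ E H)
  {M : Type*} [TopologicalSpace M] [ChartedSpace H M] [IsManifold I ∞ M]
  [RiemannianBundle (fun x : M => TangentSpace I x)]

/-- `X` is a smooth vector field, `X ∈ Γ(TM)`. -/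
def IsSmoothVectorField (X : Π x : M, TangentSpace I x) : Prop :=
  ContMDiff I I.tangent ∞ (fun x => (⟨x, X x⟩ : TangentBundle I M))

/-- `(g, J)` is a metallic Riemannian structure with parameters `p, q ∈ ℕ*`: `J` is a smooth
`(1,1)`-tensor field with `J² = p J + q I` which is symmetric with respect to the metric.
For `p = q = 1` it is a Golden Riemannian structure. -/
structure IsMetallicRiemannian (p q : ℕ)
    (J : Π x : M, TangentSpace I x →L[ℝ] TangentSpace I x) : Prop where
  p_pos : 0 < p
  q_pos : 0 < q
  smooth : ContMDiff I (I.prod 𝓘(ℝ, E →L[ℝ] E)) ∞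
    (fun x => TotalSpace.mk' (E →L[ℝ] E)
      (E := fun x : M => TangentSpace I x →L[ℝ] TangentSpace I x) x (J x))
  sq : ∀ (x : M) (v : TangentSpace I x), J x (J x v) = (p : ℝ) • J x v + (q : ℝ) • v
  symm : ∀ (x : M) (v w : TangentSpace I x), inner ℝ (J x v) w = inner ℝ v (J x w)

/-- A locally metallic Riemannian structure: moreover `∇J = 0`, that is,
`∇_X (JY) = J (∇_X Y)` for all vector fields `X`, `Y`. -/
structure IsLocallyMetallicRiemannian
    [IsContMDiffRiemannianBundle I ∞ E (fun x : M => TangentSpace I x)] (p q : ℕ)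
    (J : Π x : M, TangentSpace I x →L[ℝ] TangentSpace I x) : Prop
    extends IsMetallicRiemannian I p q J where
  parallel : ∀ X Y : Π x : M, TangentSpace I x,
    IsSmoothVectorField I X → IsSmoothVectorField I Y → ∀ x : M,
      leviCivita I (fun y => J y (Y y)) x (X x) = J x (leviCivita I Y x (X x))

/-- `D` is a smooth distribution: near every point it is spanned by finitely many smooth vector
fields which are linearly independent at each point. -/
def IsSmoothDistribution (D : Π x : M, Submodule ℝ (TangentSpace I x)) : Prop :=
  ∀ x : M, ∃ (k : ℕ) (U : Set M) (X : Fin k → Π y : M, TangentSpace I y),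
    IsOpen U ∧ x ∈ U ∧
    (∀ i, ContMDiffOn I I.tangent ∞ (fun y => (⟨y, X i y⟩ : TangentBundle I M)) U) ∧
    ∀ y ∈ U, LinearIndependent ℝ (fun i => X i y) ∧
      Submodule.span ℝ (Set.range fun i => X i y) = D y

end Ambient

/-! ### Submanifolds

`f : M → M'` is the immersion, `J` is a `(1,1)`-tensor field on the ambient manifold `M'`. Vector
fields along `f` are families `V x ∈ T_{f x} M'`. A tangent vector `u` of `M` corresponds to
`df u`. -/

section Submanifold

variable {E : Type*} [NormedAddCommGroup E] [NormedSpace ℝ E] [FiniteDimensional ℝ E]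
  {H : Type*} [TopologicalSpace H] (I : ModelWithCorners ℝ E H)
  {M : Type*} [TopologicalSpace M] [ChartedSpace H M] [IsManifold I ∞ M]
  [RiemannianBundle (fun x : M => TangentSpace I x)]
  [IsContMDiffRiemannianBundle I ∞ E (fun x : M => TangentSpace I x)]
  {E' : Type*} [NormedAddCommGroup E'] [NormedSpace ℝ E'] [FiniteDimensional ℝ E']
  {H' : Type*} [TopologicalSpace H'] (I' : ModelWithCorners ℝ E' H')
  {M' : Type*} [TopologicalSpace M'] [ChartedSpace H' M'] [IsManifold I' ∞ M']
  [RiemannianBundle (fun x : M' => TangentSpace I' x)]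
  [IsContMDiffRiemannianBundle I' ∞ E' (fun x : M' => TangentSpace I' x)]
  (J : Π x : M', TangentSpace I' x →L[ℝ] TangentSpace I' x)
  (f : M → M')

/-- `f : M → M'` is an isometric immersion: it is smooth and the metric of `M` is induced by the
metric of `M'` (so that the differential of `f` is injective). -/
structure IsIsometricImmersion : Prop where
  contMDiff : ContMDiff I I' ∞ f
  inner_mfderiv : ∀ (x : M) (u v : TangentSpace I x),
    inner ℝ (mfderiv I I' f x u) (mfderiv I I' f x v) = inner ℝ u v

/-- The tangential part `w^T ∈ T_x M` of `w ∈ T_{f x} M'`, determined by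
`⟪w^T, u⟫ = ⟪w, df u⟫` for all `u ∈ T_x M`. -/
def tangentPart (x : M) : TangentSpace I' (f x) →L[ℝ] TangentSpace I x :=
  haveI : CompleteSpace (TangentSpace I x) := FiniteDimensional.complete ℝ _
  haveI : CompleteSpace (TangentSpace I' (f x)) := FiniteDimensional.complete ℝ _
  ContinuousLinearMap.adjoint (mfderiv I I' f x)

/-- The normal part `w^⊥ = w - df (w^T)` of `w ∈ T_{f x} M'`. -/
def normalPart (x : M) : TangentSpace I' (f x) →L[ℝ] TangentSpace I' (f x) :=
  ContinuousLinearMap.id ℝ _ - mfderiv I I' f x ∘L tangentPart I I' f x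

theorem tangentPart_mfderiv (hf : IsIsometricImmersion I I' f) (x : M) (u : TangentSpace I x) :
    tangentPart I I' f x (mfderiv I I' f x u) = u := by
  have : CompleteSpace (TangentSpace I x) := FiniteDimensional.complete ℝ _
  have : CompleteSpace (TangentSpace I' (f x)) := FiniteDimensional.complete ℝ _
  refine ext_inner_right ℝ fun v => ?_
  rw [tangentPart, ContinuousLinearMap.adjoint_inner_left, hf.inner_mfderiv]

theorem inner_normalPart (hf : IsIsometricImmersion I I' f) (x : M)
    (w : TangentSpace I' (f x)) (u : TangentSpace I x) :
    inner ℝ (mfderiv I I' f x u) (normalPart I I' f x w) = 0 := by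
  have : CompleteSpace (TangentSpace I x) := FiniteDimensional.complete ℝ _
  have : CompleteSpace (TangentSpace I' (f x)) := FiniteDimensional.complete ℝ _
  simp only [normalPart, sub_apply, ContinuousLinearMap.comp_apply, ContinuousLinearMap.id_apply,
    inner_sub_right, hf.inner_mfderiv]
  rw [tangentPart, ContinuousLinearMap.adjoint_inner_right, sub_self]

/-- `V` is a smooth normal vector field, `V ∈ Γ(T^⊥M)`. -/
def IsSmoothNormalField (V : Π x : M, TangentSpace I' (f x)) : Prop :=
  ContMDiff I I'.tangent ∞ (fun x => (⟨f x, V x⟩ : TangentBundle I' M')) ∧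
    ∀ (x : M) (u : TangentSpace I x), inner ℝ (mfderiv I I' f x u) (V x) = 0

/-- `T u = (J u)^T` for `u` tangent to `M`. -/
def opT (x : M) : TangentSpace I x →L[ℝ] TangentSpace I x :=
  tangentPart I I' f x ∘L J (f x) ∘L mfderiv I I' f x

/-- `N u = (J u)^⊥` for `u` tangent to `M`. -/
def opN (x : M) : TangentSpace I x →L[ℝ] TangentSpace I' (f x) :=
  normalPart I I' f x ∘L J (f x) ∘L mfderiv I I' f x

/-- `n v = (J v)^⊥` for `v` normal to `M`. -/
def opn (x : M) : TangentSpace I' (f x) →L[ℝ] TangentSpace I' (f x) :=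
  normalPart I I' f x ∘L J (f x)

/-- The covariant derivative `∇'_u V` of a vector field `V` along `f` with respect to the
Levi-Civita connection `∇'` of `M'`, for `u ∈ T_x M`. In the local frame `(e_a)` of `TM'` given by
the trivialization at `f x`, a field `V = ∑ V^a (e_a ∘ f)` has
`∇'_u V = ∑ (dV^a)(u) e_a + ∇'_{df u} (∑ V^a(x) e_a)`; `FiberBundle.extend E' (V x)` is the local
field `∑ V^a(x) e_a` with constant coefficients. -/
def covDerivAlong (V : Π x : M, TangentSpace I' (f x)) (x : M) :
    TangentSpace I x →L[ℝ] TangentSpace I' (f x) :=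
  let e := trivializationAt E' (fun y : M' => TangentSpace I' y) (f x)
  e.symmL ℝ (f x) ∘L mvfderiv I (fun y : M => (e ⟨f y, V y⟩).2) x
    + leviCivita I' (FiberBundle.extend E' (V x)) (f x) ∘L mfderiv I I' f x


/-- A connection differs from the flat connection of a local trivialization by a tensor. -/
theorem tensorialAt_sub_flat (cov : CovariantDerivative I E (fun x : M => TangentSpace I x))
    (p : M)
    (e : Trivialization E (TotalSpace.proj : TotalSpace E (fun x : M => TangentSpace I x) → M))
    [MemTrivializationAtlas e] (hp : p ∈ e.baseSet) :
    TensorialAt I E (fun Y : Π x : M, TangentSpace I x => cov Y p -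
      e.symmL ℝ p ∘L mvfderiv I (fun y : M => (e ⟨y, Y y⟩).2) p) p := by
  have hd : ∀ {Y : Π x : M, TangentSpace I x}, MDiffAt (T% Y) p → MDiffAt (fun y : M => (e ⟨y, Y y⟩).2) p := by
    intro Y hY
    exact (e.mdifferentiableAt_section_iff I Y hp).1 hY
  constructor
  · intro f Y hf hY
    have h1 : (fun y : M => (e ⟨y, (f • Y) y⟩).2) =ᶠ[nhds p] f • fun y => (e ⟨y, Y y⟩).2 := by
      filter_upwards [e.open_baseSet.mem_nhds hp] with y hy
      exact (e.linear ℝ hy).2 (f y) (Y y)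
    have h2 : mvfderiv I (fun y : M => (e ⟨y, (f • Y) y⟩).2) p = mvfderiv I (f • fun y => (e ⟨y, Y y⟩).2) p := by
      unfold mvfderiv
      rw [h1.mfderiv_eq]
      ext v
      rfl
    rw [h2, mvfderiv_smul hf (hd hY), cov.isCovariantDerivativeOnUniv.leibniz hY hf]
    ext v
    have h3 : e.symmL ℝ p (e ⟨p, Y p⟩).2 = Y p := by
      rw [Trivialization.symmL_apply _ hp]
      exact e.symm_apply_apply_mk hp (Y p)
    simp only [sub_apply, add_apply, smul_apply, ContinuousLinearMap.comp_apply,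
      ContinuousLinearMap.smulRight_apply, map_add, map_smul, h3, smul_sub]
    abel
  · intro Y Y' hY hY'
    have h1 : (fun y : M => (e ⟨y, (Y + Y') y⟩).2) =ᶠ[nhds p] (fun y => (e ⟨y, Y y⟩).2) + fun y => (e ⟨y, Y' y⟩).2 := by
      filter_upwards [e.open_baseSet.mem_nhds hp] with y hy
      exact (e.linear ℝ hy).1 (Y y) (Y' y)
    have h2 : mvfderiv I (fun y : M => (e ⟨y, (Y + Y') y⟩).2) p = mvfderiv I ((fun y => (e ⟨y, Y y⟩).2) + fun y => (e ⟨y, Y' y⟩).2) p := by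
      unfold mvfderiv
      rw [h1.mfderiv_eq]
      ext v
      rfl
    rw [h2, mvfderiv_add (hd hY) (hd hY'), cov.isCovariantDerivativeOnUniv.add hY hY']
    ext v
    simp
    abel

/-- For a vector field `Y` of the ambient manifold, `∇'_X (Y ∘ f) = ∇'_{df X} Y`. -/
theorem covDerivAlong_comp {x : M} {Y : Π y : M', TangentSpace I' y}
    (hf : MDiffAt f x) (hY : MDiffAt (T% Y) (f x)) :
    covDerivAlong I I' f (fun y => Y (f y)) x
      = leviCivita I' Y (f x) ∘L mfderiv I I' f x := by
  let e := trivializationAt E' (fun y : M' => TangentSpace I' y) (f x)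
  have hp : f x ∈ e.baseSet := FiberBundle.mem_baseSet_trivializationAt' (f x)
  have h1 := (tensorialAt_sub_flat I' (leviCivita I') (f x) e hp).pointwise hY
    (FiberBundle.mdifferentiableAt_extend I' (F := E') (Y (f x))) (by simp)
  have h2 : mvfderiv I' (fun y : M' => (e ⟨y, FiberBundle.extend E' (Y (f x)) y⟩).2) (f x) = 0 := by
    have : (fun y : M' => (e ⟨y, FiberBundle.extend E' (Y (f x)) y⟩).2) =ᶠ[nhds (f x)] fun _ => (e ⟨f x, Y (f x)⟩).2 := by
      filter_upwards [e.open_baseSet.mem_nhds hp] with y hy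
      have := e.apply_mk_symm hy (e ⟨f x, Y (f x)⟩).2
      have h := congrArg Prod.snd this
      exact h
    unfold mvfderiv
    rw [this.mfderiv_eq]
    simp [mfderiv_const]
    rfl
  have hc : MDiffAt (fun y : M' => (e ⟨y, Y y⟩).2) (f x) := (e.mdifferentiableAt_section_iff I' Y hp).1 hY
  have h3 : mvfderiv I (fun y : M => (e ⟨f y, Y (f y)⟩).2) x
      = mvfderiv I' (fun y : M' => (e ⟨y, Y y⟩).2) (f x) ∘L mfderiv I I' f x :=
    by
      have h := mfderiv_comp x (g := fun y : M' => (e ⟨y, Y y⟩).2) hc hf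
      ext v
      exact congrArg (fun L => L v) h
  rw [h2, ContinuousLinearMap.comp_zero, sub_zero] at h1
  change e.symmL ℝ (f x) ∘L mvfderiv I (fun y : M => (e ⟨f y, Y (f y)⟩).2) x
    + leviCivita I' (FiberBundle.extend E' (Y (f x))) (f x) ∘L mfderiv I I' f x = _
  rw [h3, ← h1]
  ext v
  simp

/-- Weingarten's formula, tangential part: the shape operator `A_V u = -(∇'_u V)^T`. -/
def shapeOperator (V : Π x : M, TangentSpace I' (f x)) (x : M) :
    TangentSpace I x →L[ℝ] TangentSpace I x :=
  -(tangentPart I I' f x ∘L covDerivAlong I I' f V x)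

/-- Weingarten's formula, normal part: the normal connection `∇^⊥_u V = (∇'_u V)^⊥`. -/
def normalConnection (V : Π x : M, TangentSpace I' (f x)) (x : M) :
    TangentSpace I x →L[ℝ] TangentSpace I' (f x) :=
  normalPart I I' f x ∘L covDerivAlong I I' f V x

/-- The covariant derivative of `N`: `(∇'_u N) Y = ∇^⊥_u (NY) - N (∇_u Y)`, where `∇` is the
Levi-Civita connection of `M`. -/
def covDerivN (Y : Π x : M, TangentSpace I x) (x : M) :
    TangentSpace I x →L[ℝ] TangentSpace I' (f x) :=
  normalConnection I I' f (fun y => opN I I' J f y (Y y)) x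
    - opN I I' J f x ∘L leviCivita I Y x

/-- `N` is parallel: `(∇'_X N) Y = 0` for all vector fields `X`, `Y` on `M`. -/
def IsParallelN : Prop :=
  ∀ X Y : Π x : M, TangentSpace I x, IsSmoothVectorField I X → IsSmoothVectorField I Y →
    ∀ x : M, covDerivN I I' J f Y x (X x) = 0

/-- `D` is a slant distribution with slant angle `θ`: for every nonzero `u ∈ D x` the angle between
`J u` and the subspace `D x`, i.e. between `J u` and its orthogonal projection onto `D x`, is `θ`
(it is `π / 2` if this projection vanishes). -/
def IsSlantDistribution (D : Π x : M, Submodule ℝ (TangentSpace I x)) (θ : ℝ) : Prop :=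
  ∀ (x : M), ∀ u ∈ D x, u ≠ 0 →
    InnerProductGeometry.angle (J (f x) (mfderiv I I' f x u))
      (((D x).map (mfderiv I I' f x).toLinearMap).starProjection
        (J (f x) (mfderiv I I' f x u))) = θ

/-- `M` is a semi-slant submanifold: `TM = D₁ ⊕ D₂` is an orthogonal sum of two smooth
distributions, `J D₁ = D₁`, and `D₂` is slant with an angle `θ ≠ 0`. -/
def IsSemiSlantSubmanifold : Prop :=
  ∃ (D₁ D₂ : Π x : M, Submodule ℝ (TangentSpace I x)) (θ : ℝ),
    IsSmoothDistribution I D₁ ∧ IsSmoothDistribution I D₂ ∧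
    (∀ x, (D₁ x).IsOrtho (D₂ x) ∧ D₁ x ⊔ D₂ x = ⊤) ∧
    (∀ x, ((D₁ x).map (mfderiv I I' f x).toLinearMap).map (J (f x)).toLinearMap
      = (D₁ x).map (mfderiv I I' f x).toLinearMap) ∧
    θ ≠ 0 ∧ IsSlantDistribution I I' J f D₂ θ

end Submanifold

end MetallicGeometry

end

open MetallicGeometry

namespace MetallicGeometry

section VectorFieldsAlong

variable {E : Type*} [NormedAddCommGroup E] [NormedSpace ℝ E]
  {H : Type*} [TopologicalSpace H] {I : ModelWithCorners ℝ E H}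
  {M : Type*} [TopologicalSpace M] [ChartedSpace H M]
  {E' : Type*} [NormedAddCommGroup E'] [NormedSpace ℝ E']
  {H' : Type*} [TopologicalSpace H'] {I' : ModelWithCorners ℝ E' H'}
  {M' : Type*} [TopologicalSpace M'] [ChartedSpace H' M'] [IsManifold I' ∞ M']
  {f : M → M'} {x : M}

/-! ### Differentiability of vector fields along a map -/

theorem mdifferentiableAt_along_iff (hf : MDifferentiableAt I I' f x)
    {V : Π y : M, TangentSpace I' (f y)} :
    MDifferentiableAt I I'.tangent (fun y => (⟨f y, V y⟩ : TangentBundle I' M')) x ↔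
      MDifferentiableAt I 𝓘(ℝ, E')
        (fun y => (trivializationAt E' (fun z : M' => TangentSpace I' z) (f x) ⟨f y, V y⟩).2) x := by
  rw [mdifferentiableAt_totalSpace]
  exact and_iff_right hf

theorem contMDiffAt_along_iff {n : WithTop ℕ∞} (hf : ContMDiffAt I I' n f x)
    {V : Π y : M, TangentSpace I' (f y)} :
    ContMDiffAt I I'.tangent n (fun y => (⟨f y, V y⟩ : TangentBundle I' M')) x ↔
      ContMDiffAt I 𝓘(ℝ, E') n
        (fun y => (trivializationAt E' (fun z : M' => TangentSpace I' z) (f x) ⟨f y, V y⟩).2) x := by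
  rw [contMDiffAt_totalSpace]
  exact and_iff_right hf

theorem eventually_mem_baseSet (hf : ContinuousAt f x) :
    ∀ᶠ y in nhds x, f y ∈
      (trivializationAt E' (fun z : M' => TangentSpace I' z) (f x)).baseSet :=
  hf.preimage_mem_nhds ((trivializationAt E' (fun z : M' => TangentSpace I' z)
    (f x)).open_baseSet.mem_nhds (FiberBundle.mem_baseSet_trivializationAt' (f x)))

theorem eventually_trivialization_add (hf : ContinuousAt f x)
    (V W : Π y : M, TangentSpace I' (f y)) :
    (fun y => (trivializationAt E' (fun z : M' => TangentSpace I' z) (f x) ⟨f y, V y + W y⟩).2)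
      =ᶠ[nhds x]
    (fun y => (trivializationAt E' (fun z : M' => TangentSpace I' z) (f x) ⟨f y, V y⟩).2)
      + fun y => (trivializationAt E' (fun z : M' => TangentSpace I' z) (f x) ⟨f y, W y⟩).2 := by
  filter_upwards [eventually_mem_baseSet (I' := I') hf] with y hy
  exact ((trivializationAt E' (fun z : M' => TangentSpace I' z) (f x)).linear ℝ hy).1 _ _

theorem eventually_trivialization_smul (hf : ContinuousAt f x) (c : M → ℝ)
    (V : Π y : M, TangentSpace I' (f y)) :
    (fun y => (trivializationAt E' (fun z : M' => TangentSpace I' z) (f x) ⟨f y, c y • V y⟩).2)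
      =ᶠ[nhds x]
    c • fun y => (trivializationAt E' (fun z : M' => TangentSpace I' z) (f x) ⟨f y, V y⟩).2 := by
  filter_upwards [eventually_mem_baseSet (I' := I') hf] with y hy
  exact ((trivializationAt E' (fun z : M' => TangentSpace I' z) (f x)).linear ℝ hy).2 _ _

theorem mdifferentiableAt_along_add (hf : MDifferentiableAt I I' f x)
    {V W : Π y : M, TangentSpace I' (f y)}
    (hV : MDifferentiableAt I I'.tangent (fun y => (⟨f y, V y⟩ : TangentBundle I' M')) x)
    (hW : MDifferentiableAt I I'.tangent (fun y => (⟨f y, W y⟩ : TangentBundle I' M')) x) :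
    MDifferentiableAt I I'.tangent (fun y => (⟨f y, V y + W y⟩ : TangentBundle I' M')) x := by
  rw [mdifferentiableAt_along_iff hf] at hV hW ⊢
  exact (hV.add hW).congr_of_eventuallyEq (eventually_trivialization_add hf.continuousAt V W)

theorem mdifferentiableAt_along_smul (hf : MDifferentiableAt I I' f x)
    {c : M → ℝ} {V : Π y : M, TangentSpace I' (f y)} (hc : MDifferentiableAt I 𝓘(ℝ, ℝ) c x)
    (hV : MDifferentiableAt I I'.tangent (fun y => (⟨f y, V y⟩ : TangentBundle I' M')) x) :
    MDifferentiableAt I I'.tangent (fun y => (⟨f y, c y • V y⟩ : TangentBundle I' M')) x := by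
  rw [mdifferentiableAt_along_iff hf] at hV ⊢
  exact (hc.smul hV).congr_of_eventuallyEq (eventually_trivialization_smul hf.continuousAt c V)

theorem contMDiffAt_along_add {n : WithTop ℕ∞} (hf : ContMDiffAt I I' n f x)
    {V W : Π y : M, TangentSpace I' (f y)}
    (hV : ContMDiffAt I I'.tangent n (fun y => (⟨f y, V y⟩ : TangentBundle I' M')) x)
    (hW : ContMDiffAt I I'.tangent n (fun y => (⟨f y, W y⟩ : TangentBundle I' M')) x) :
    ContMDiffAt I I'.tangent n (fun y => (⟨f y, V y + W y⟩ : TangentBundle I' M')) x := by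
  rw [contMDiffAt_along_iff hf] at hV hW ⊢
  exact (hV.add hW).congr_of_eventuallyEq (eventually_trivialization_add hf.continuousAt V W)

theorem contMDiffAt_along_smul {n : WithTop ℕ∞} (hf : ContMDiffAt I I' n f x)
    {c : M → ℝ} {V : Π y : M, TangentSpace I' (f y)} (hc : ContMDiffAt I 𝓘(ℝ, ℝ) n c x)
    (hV : ContMDiffAt I I'.tangent n (fun y => (⟨f y, V y⟩ : TangentBundle I' M')) x) :
    ContMDiffAt I I'.tangent n (fun y => (⟨f y, c y • V y⟩ : TangentBundle I' M')) x := by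
  rw [contMDiffAt_along_iff hf] at hV ⊢
  exact (hc.smul hV).congr_of_eventuallyEq (eventually_trivialization_smul hf.continuousAt c V)

variable [FiniteDimensional ℝ E'] [T2Space M']

theorem exists_smooth_extension {z : M'} {Y : Π y : M', TangentSpace I' y}
    {s : Set M'} (hs : s ∈ nhds z)
    (hY : ContMDiffOn I' I'.tangent ∞ (fun y => (⟨y, Y y⟩ : TangentBundle I' M')) s) :
    ∃ Z : Π y : M', TangentSpace I' y, IsSmoothVectorField I' Z ∧ Z =ᶠ[nhds z] Y := by
  obtain ⟨u, hus, hu, hzu⟩ := mem_nhds_iff.1 hs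
  obtain ⟨ψ, hψ⟩ : ∃ ψ : SmoothBumpFunction I' z, tsupport ψ ⊆ u := by
    obtain ⟨ψ, -, h⟩ :=
      (SmoothBumpFunction.nhds_basis_tsupport (I := I') z).mem_iff.1 (hu.mem_nhds hzu)
    exact ⟨ψ, h⟩
  refine ⟨(ψ : M' → ℝ) • Y, ?_, ?_⟩
  · exact ContMDiffOn.smul_section_of_tsupport (V := fun y : M' => TangentSpace I' y)
      ψ.contMDiff.contMDiffOn hu hψ (hY.mono hus)
  · filter_upwards [ψ.eventuallyEq_one] with y hy
    have h : (ψ : M' → ℝ) y • Y y = Y y := by rw [hy]; exact one_smul ℝ (Y y)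
    exact h

theorem exists_smoothVectorField_apply_eq {z : M'} (v : TangentSpace I' z) :
    ∃ Z : Π y : M', TangentSpace I' y, IsSmoothVectorField I' Z ∧ Z z = v := by
  obtain ⟨s, hs, h⟩ := FiberBundle.exists_contMDiffOn_extend (k := ∞) I' E' v
  obtain ⟨Z, hZ, hZY⟩ := exists_smooth_extension hs h
  exact ⟨Z, hZ, hZY.self_of_nhds.trans (FiberBundle.extend_apply_self E' v)⟩

/-- Near `x`, a vector field along `f` which is differentiable at `x` is a combination of
restrictions of smooth ambient vector fields. -/
theorem along_induction (hf : MDifferentiableAt I I' f x)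
    {P : (Π y : M, TangentSpace I' (f y)) → Prop}
    (congr : ∀ {V W : Π y : M, TangentSpace I' (f y)}, V =ᶠ[nhds x] W → P W → P V)
    (zero : P fun _ => 0)
    (add : ∀ {V W : Π y : M, TangentSpace I' (f y)},
      MDifferentiableAt I I'.tangent (fun y => (⟨f y, V y⟩ : TangentBundle I' M')) x →
      MDifferentiableAt I I'.tangent (fun y => (⟨f y, W y⟩ : TangentBundle I' M')) x →
      P V → P W → P fun y => V y + W y)
    (smul : ∀ {c : M → ℝ} {Y : Π y : M', TangentSpace I' y}, MDifferentiableAt I 𝓘(ℝ, ℝ) c x →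
      IsSmoothVectorField I' Y → P fun y => c y • Y (f y))
    {V : Π y : M, TangentSpace I' (f y)}
    (hV : MDifferentiableAt I I'.tangent (fun y => (⟨f y, V y⟩ : TangentBundle I' M')) x) :
    P V := by
  let t := trivializationAt E' (fun z : M' => TangentSpace I' z) (f x)
  let b := Module.finBasis ℝ E'
  have hx : f x ∈ t.baseSet := FiberBundle.mem_baseSet_trivializationAt' (f x)
  have hZ : ∀ i, ∃ Z : Π y : M', TangentSpace I' y, IsSmoothVectorField I' Z ∧
      Z =ᶠ[nhds (f x)] t.localFrame b i := fun i =>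
    exists_smooth_extension (t.open_baseSet.mem_nhds hx)
      (t.contMDiffOn_localFrame_baseSet (I := I') ∞ b i)
  choose Z hZs hZe using hZ
  let c : Fin (Module.finrank ℝ E') → M → ℝ := fun i y => b.repr (t ⟨f y, V y⟩).2 i
  have hc : ∀ i, MDifferentiableAt I 𝓘(ℝ, ℝ) (c i) x := fun i => by
    have h1 := (mdifferentiableAt_along_iff hf).1 hV
    have h2 : MDifferentiableAt 𝓘(ℝ, E') 𝓘(ℝ, ℝ) (b.coord i).toContinuousLinearMap
      ((t ⟨f x, V x⟩).2) := (b.coord i).toContinuousLinearMap.mdifferentiableAt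
    exact h2.comp x h1
  have key : ∀ s : Finset (Fin (Module.finrank ℝ E')),
      MDifferentiableAt I I'.tangent
        (fun y => (⟨f y, ∑ i ∈ s, c i y • Z i (f y)⟩ : TangentBundle I' M')) x ∧
      P fun y => ∑ i ∈ s, c i y • Z i (f y) := by
    intro s
    induction s using Finset.induction_on with
    | empty =>
      simp only [Finset.sum_empty]
      refine ⟨?_, zero⟩
      exact (mdifferentiable_zeroSection ℝ (F := E') (E := fun z : M' => TangentSpace I' z)
        (IB := I') (f x)).comp x hf
    | insert i s hi ih =>
      simp only [Finset.sum_insert hi]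
      have h1 : MDifferentiableAt I I'.tangent
        (fun y => (⟨f y, c i y • Z i (f y)⟩ : TangentBundle I' M')) x :=
        mdifferentiableAt_along_smul hf (hc i)
          (((hZs i).mdifferentiable (by simp) (f x)).comp x hf)
      exact ⟨mdifferentiableAt_along_add hf h1 ih.1, add h1 ih.1 (smul (hc i) (hZs i)) ih.2⟩
  refine congr ?_ (key Finset.univ).2
  have hZe' : ∀ᶠ y in nhds x, ∀ i, Z i (f y) = t.localFrame b i (f y) :=
    Filter.eventually_all.2 fun i => hf.continuousAt.eventually (hZe i)
  filter_upwards [hZe', eventually_mem_baseSet (I' := I') hf.continuousAt] with y hy hy'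
  simp only [hy, c]
  have h3 := t.eq_sum_localFrameCoeff_smul (I := I') (b := b) (x' := f y)
    (s := FiberBundle.extend E' (V y)) hy'
  have h4 : ∀ i, t.localFrameCoeff I' b i (f y) (FiberBundle.extend E' (V y) (f y))
      = b.repr (t ⟨f y, FiberBundle.extend E' (V y) (f y)⟩).2 i := fun i =>
    t.localFrameCoeff_eq_coeff hy'
  simp only [h4] at h3
  simp only [FiberBundle.extend_apply_self] at h3
  exact h3

end VectorFieldsAlong

section CovariantDerivativeAlong

variable {E : Type*} [NormedAddCommGroup E] [NormedSpace ℝ E] [FiniteDimensional ℝ E]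
  {H : Type*} [TopologicalSpace H] {I : ModelWithCorners ℝ E H}
  {M : Type*} [TopologicalSpace M] [ChartedSpace H M] [IsManifold I ∞ M]
  [RiemannianBundle (fun x : M => TangentSpace I x)]
  [IsContMDiffRiemannianBundle I ∞ E (fun x : M => TangentSpace I x)]
  {E' : Type*} [NormedAddCommGroup E'] [NormedSpace ℝ E'] [FiniteDimensional ℝ E']
  {H' : Type*} [TopologicalSpace H'] {I' : ModelWithCorners ℝ E' H'}
  {M' : Type*} [TopologicalSpace M'] [ChartedSpace H' M'] [IsManifold I' ∞ M']
  [RiemannianBundle (fun x : M' => TangentSpace I' x)]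
  [IsContMDiffRiemannianBundle I' ∞ E' (fun x : M' => TangentSpace I' x)]
  {J : Π x : M', TangentSpace I' x →L[ℝ] TangentSpace I' x}
  {f : M → M'} {x : M}

/-! ### The covariant derivative of vector fields along a map -/

theorem mvfderiv_congr {F : Type*} [NormedAddCommGroup F] [NormedSpace ℝ F] {g h : M → F}
    (hgh : g =ᶠ[nhds x] h) : mvfderiv I g x = mvfderiv I h x := by
  have h1 := Filter.EventuallyEq.mfderiv_eq (I := I) (I' := 𝓘(ℝ, F)) hgh
  ext v
  exact congrArg (fun L : E →L[ℝ] F => L v) h1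

theorem covDerivAlong_congr {V W : Π y : M, TangentSpace I' (f y)} (h : V =ᶠ[nhds x] W) :
    covDerivAlong I I' f V x = covDerivAlong I I' f W x := by
  have h1 : (fun y : M => (trivializationAt E' (fun z : M' => TangentSpace I' z) (f x)
      ⟨f y, V y⟩).2) =ᶠ[nhds x] fun y : M => (trivializationAt E'
        (fun z : M' => TangentSpace I' z) (f x) ⟨f y, W y⟩).2 := by
    filter_upwards [h] with y hy
    rw [hy]
  simp only [covDerivAlong]
  rw [mvfderiv_congr h1, h.self_of_nhds]

theorem leviCivita_extend_add {z : M'} (v w : TangentSpace I' z) :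
    leviCivita I' (FiberBundle.extend E' (v + w)) z
      = leviCivita I' (FiberBundle.extend E' v) z + leviCivita I' (FiberBundle.extend E' w) z := by
  have hz : z ∈ (trivializationAt E' (fun z : M' => TangentSpace I' z) z).baseSet :=
    FiberBundle.mem_baseSet_trivializationAt' z
  have hv := FiberBundle.mdifferentiableAt_extend I' E' v
  have hw := FiberBundle.mdifferentiableAt_extend I' E' w
  rw [← (leviCivita I').isCovariantDerivativeOnUniv.add hv hw]
  refine (leviCivita I').isCovariantDerivativeOnUniv.congr_of_eventuallyEq
    (FiberBundle.mdifferentiableAt_extend ..) (mdifferentiableAt_add_section hv hw)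
    Filter.univ_mem ?_
  filter_upwards [(trivializationAt E' (fun z : M' => TangentSpace I' z) z).open_baseSet.mem_nhds hz]
    with y hy
  have h := ((trivializationAt E' (fun z : M' => TangentSpace I' z) z).linear ℝ hz).1 v w
  refine (congrArg ((trivializationAt E' (fun z : M' => TangentSpace I' z) z).symm y) h).trans ?_
  simp only [FiberBundle.extend, Pi.add_apply, ← Trivialization.symmₗ_apply (R := ℝ) _ hy]
  exact ((trivializationAt E' (fun z : M' => TangentSpace I' z) z).symmₗ ℝ y).map_add
    ((trivializationAt E' (fun z : M' => TangentSpace I' z) z) ⟨z, v⟩).2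
    ((trivializationAt E' (fun z : M' => TangentSpace I' z) z) ⟨z, w⟩).2

theorem leviCivita_extend_smul {z : M'} (c : ℝ) (v : TangentSpace I' z) :
    leviCivita I' (FiberBundle.extend E' (c • v)) z
      = c • leviCivita I' (FiberBundle.extend E' v) z := by
  have hz : z ∈ (trivializationAt E' (fun z : M' => TangentSpace I' z) z).baseSet :=
    FiberBundle.mem_baseSet_trivializationAt' z
  have hv := FiberBundle.mdifferentiableAt_extend I' E' v
  rw [← (leviCivita I').isCovariantDerivativeOnUniv.smul_const c hv]
  refine (leviCivita I').isCovariantDerivativeOnUniv.congr_of_eventuallyEq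
    (FiberBundle.mdifferentiableAt_extend ..) (hv.smul_const_section)
    Filter.univ_mem ?_
  filter_upwards [(trivializationAt E' (fun z : M' => TangentSpace I' z) z).open_baseSet.mem_nhds hz]
    with y hy
  have h := ((trivializationAt E' (fun z : M' => TangentSpace I' z) z).linear ℝ hz).2 c v
  refine (congrArg ((trivializationAt E' (fun z : M' => TangentSpace I' z) z).symm y) h).trans ?_
  simp only [FiberBundle.extend, Pi.smul_apply, ← Trivialization.symmₗ_apply (R := ℝ) _ hy]
  exact ((trivializationAt E' (fun z : M' => TangentSpace I' z) z).symmₗ ℝ y).map_smul c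
    ((trivializationAt E' (fun z : M' => TangentSpace I' z) z) ⟨z, v⟩).2

theorem covDerivAlong_add (hf : MDifferentiableAt I I' f x)
    {V W : Π y : M, TangentSpace I' (f y)}
    (hV : MDifferentiableAt I I'.tangent (fun y => (⟨f y, V y⟩ : TangentBundle I' M')) x)
    (hW : MDifferentiableAt I I'.tangent (fun y => (⟨f y, W y⟩ : TangentBundle I' M')) x) :
    covDerivAlong I I' f (fun y => V y + W y) x
      = covDerivAlong I I' f V x + covDerivAlong I I' f W x := by
  rw [mdifferentiableAt_along_iff hf] at hV hW
  simp only [covDerivAlong]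
  rw [mvfderiv_congr (eventually_trivialization_add hf.continuousAt V W), mvfderiv_add hV hW,
    leviCivita_extend_add]
  ext v
  simp
  abel

theorem covDerivAlong_smul (hf : MDifferentiableAt I I' f x)
    {c : M → ℝ} {V : Π y : M, TangentSpace I' (f y)} (hc : MDifferentiableAt I 𝓘(ℝ, ℝ) c x)
    (hV : MDifferentiableAt I I'.tangent (fun y => (⟨f y, V y⟩ : TangentBundle I' M')) x) :
    covDerivAlong I I' f (fun y => c y • V y) x
      = c x • covDerivAlong I I' f V x + (mvfderiv I c x).smulRight (V x) := by
  have hx : f x ∈ (trivializationAt E' (fun z : M' => TangentSpace I' z) (f x)).baseSet :=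
    FiberBundle.mem_baseSet_trivializationAt' (f x)
  rw [mdifferentiableAt_along_iff hf] at hV
  simp only [covDerivAlong]
  rw [mvfderiv_congr (eventually_trivialization_smul hf.continuousAt c V), mvfderiv_smul hc hV,
    leviCivita_extend_smul]
  have h3 : (trivializationAt E' (fun z : M' => TangentSpace I' z) (f x)).symmL ℝ (f x)
      ((trivializationAt E' (fun z : M' => TangentSpace I' z) (f x)) ⟨f x, V x⟩).2 = V x := by
    rw [Trivialization.symmL_apply _ hx]
    exact Trivialization.symm_apply_apply_mk _ hx (V x)
  ext v
  simp only [add_apply, smul_apply, ContinuousLinearMap.comp_apply,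
    ContinuousLinearMap.smulRight_apply, map_add, map_smul, h3, smul_add]
  abel

theorem covDerivAlong_zero (hf : MDifferentiableAt I I' f x) :
    covDerivAlong I I' f (fun _ => 0) x = 0 := by
  have h0 : MDifferentiableAt I I'.tangent (fun y => (⟨f y, 0⟩ : TangentBundle I' M')) x :=
    (mdifferentiable_zeroSection ℝ (F := E') (E := fun z : M' => TangentSpace I' z)
      (IB := I') (f x)).comp x hf
  have h := covDerivAlong_add hf h0 h0
  simpa using h

variable [T2Space M']

/-- `∇'_u (J V) = J (∇'_u V)` for vector fields along a map, if `∇' J = 0`. -/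
theorem covDerivAlong_parallel {p q : ℕ} (hJ : IsLocallyMetallicRiemannian I' p q J)
    (hf : MDifferentiableAt I I' f x) {V : Π y : M, TangentSpace I' (f y)}
    (hV : MDifferentiableAt I I'.tangent (fun y => (⟨f y, V y⟩ : TangentBundle I' M')) x) :
    MDifferentiableAt I I'.tangent
        (fun y => (⟨f y, J (f y) (V y)⟩ : TangentBundle I' M')) x ∧
      covDerivAlong I I' f (fun y => J (f y) (V y)) x
        = J (f x) ∘L covDerivAlong I I' f V x := by
  refine along_induction (I := I) (I' := I') (f := f) (x := x) (P := fun V =>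
    MDifferentiableAt I I'.tangent
        (fun y => (⟨f y, J (f y) (V y)⟩ : TangentBundle I' M')) x ∧
      covDerivAlong I I' f (fun y => J (f y) (V y)) x
        = J (f x) ∘L covDerivAlong I I' f V x) hf ?_ ?_ ?_ ?_ hV
  · intro V W h hW
    have h' : (fun y => J (f y) (V y)) =ᶠ[nhds x] fun y => J (f y) (W y) := by
      filter_upwards [h] with y hy
      rw [hy]
    rw [covDerivAlong_congr h, covDerivAlong_congr h']
    refine ⟨hW.1.congr_of_eventuallyEq ?_, hW.2⟩
    filter_upwards [h] with y hy
    rw [hy]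
  · simp only [map_zero]
    refine ⟨(mdifferentiable_zeroSection ℝ (F := E') (E := fun z : M' => TangentSpace I' z)
      (IB := I') (f x)).comp x hf, ?_⟩
    rw [covDerivAlong_zero hf, ContinuousLinearMap.comp_zero]
  · intro V W hV hW hV' hW'
    simp only [map_add]
    refine ⟨mdifferentiableAt_along_add hf hV'.1 hW'.1, ?_⟩
    rw [covDerivAlong_add hf hV'.1 hW'.1, covDerivAlong_add hf hV hW, hV'.2, hW'.2,
      ContinuousLinearMap.comp_add]
  · intro c Y hc hY
    have hJY : IsSmoothVectorField I' fun y => J y (Y y) :=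
      ContMDiff.clm_bundle_apply (F₁ := E') (F₂ := E') (E₁ := fun y : M' => TangentSpace I' y)
        (E₂ := fun y : M' => TangentSpace I' y) hJ.smooth hY
    have h1 := (hY.mdifferentiable (by simp) (f x))
    have h2 := (hJY.mdifferentiable (by simp) (f x))
    simp only [map_smul]
    refine ⟨mdifferentiableAt_along_smul hf hc (h2.comp x hf), ?_⟩
    rw [covDerivAlong_smul (V := fun y => J (f y) (Y (f y))) hf hc (h2.comp x hf),
      covDerivAlong_smul (V := fun y => Y (f y)) hf hc (h1.comp x hf),
      covDerivAlong_comp I I' f (Y := fun y => J y (Y y)) hf h2,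
      covDerivAlong_comp I I' f hf h1]
    have h3 : leviCivita I' (fun y => J y (Y y)) (f x)
        = J (f x) ∘L leviCivita I' Y (f x) := by
      ext u
      obtain ⟨X, hX, rfl⟩ := exists_smoothVectorField_apply_eq (I' := I') u
      exact hJ.parallel X Y hX hY (f x)
    rw [h3]
    ext u
    simp

theorem mdifferentiableAt_inner_along {V W : Π y : M, TangentSpace I' (f y)}
    (hV : MDifferentiableAt I I'.tangent (fun y => (⟨f y, V y⟩ : TangentBundle I' M')) x)
    (hW : MDifferentiableAt I I'.tangent (fun y => (⟨f y, W y⟩ : TangentBundle I' M')) x) :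
    MDifferentiableAt I 𝓘(ℝ, ℝ) (fun y => inner ℝ (V y) (W y)) x :=
  MDifferentiableAt.inner_bundle (IB := I') (F := E') (E := fun z : M' => TangentSpace I' z)
    (b := f) hV hW

theorem mvfderiv_inner_smul_comp (hf : MDifferentiableAt I I' f x)
    {c : M → ℝ} {Y : Π y : M', TangentSpace I' y} {W : Π y : M, TangentSpace I' (f y)}
    (hc : MDifferentiableAt I 𝓘(ℝ, ℝ) c x) (hY : IsSmoothVectorField I' Y)
    (hW : MDifferentiableAt I I'.tangent (fun y => (⟨f y, W y⟩ : TangentBundle I' M')) x)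
    (h : ∀ u : TangentSpace I x, mvfderiv I (fun y => inner ℝ (Y (f y)) (W y)) x u
      = inner ℝ (covDerivAlong I I' f (fun y => Y (f y)) x u) (W x)
        + inner ℝ (Y (f x)) (covDerivAlong I I' f W x u)) (u : TangentSpace I x) :
    mvfderiv I (fun y => inner ℝ (c y • Y (f y)) (W y)) x u
      = inner ℝ (covDerivAlong I I' f (fun y => c y • Y (f y)) x u) (W x)
        + inner ℝ (c x • Y (f x)) (covDerivAlong I I' f W x u) := by
  have h1 : MDifferentiableAt I I'.tangent
      (fun y => (⟨f y, Y (f y)⟩ : TangentBundle I' M')) x :=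
    (hY.mdifferentiable (by simp) (f x)).comp x hf
  have h2 : (fun y => inner ℝ (c y • Y (f y)) (W y))
      = fun y => c y * inner ℝ (Y (f y)) (W y) := by
    funext y
    rw [real_inner_smul_left]
  rw [h2, mvfderiv_fun_mul hc (mdifferentiableAt_inner_along h1 hW),
    covDerivAlong_smul (V := fun y => Y (f y)) hf hc h1]
  simp [h, inner_add_left, real_inner_smul_left]
  ring

/-- The Levi-Civita connection along a map is compatible with the metric. -/
theorem mvfderiv_inner_along (hf : MDifferentiableAt I I' f x)
    {V W : Π y : M, TangentSpace I' (f y)}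
    (hV : MDifferentiableAt I I'.tangent (fun y => (⟨f y, V y⟩ : TangentBundle I' M')) x)
    (hW : MDifferentiableAt I I'.tangent (fun y => (⟨f y, W y⟩ : TangentBundle I' M')) x)
    (u : TangentSpace I x) :
    mvfderiv I (fun y => inner ℝ (V y) (W y)) x u
      = inner ℝ (covDerivAlong I I' f V x u) (W x)
        + inner ℝ (V x) (covDerivAlong I I' f W x u) := by
  have aux : ∀ W : Π y : M, TangentSpace I' (f y),
      MDifferentiableAt I I'.tangent (fun y => (⟨f y, W y⟩ : TangentBundle I' M')) x →
      (∀ Y : Π y : M', TangentSpace I' y, IsSmoothVectorField I' Y →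
        ∀ u : TangentSpace I x, mvfderiv I (fun y => inner ℝ (Y (f y)) (W y)) x u
      = inner ℝ (covDerivAlong I I' f (fun y => Y (f y)) x u) (W x)
        + inner ℝ (Y (f x)) (covDerivAlong I I' f W x u)) →
      ∀ V : Π y : M, TangentSpace I' (f y),
      MDifferentiableAt I I'.tangent (fun y => (⟨f y, V y⟩ : TangentBundle I' M')) x →
      ∀ u : TangentSpace I x, mvfderiv I (fun y => inner ℝ (V y) (W y)) x u
      = inner ℝ (covDerivAlong I I' f V x u) (W x)
        + inner ℝ (V x) (covDerivAlong I I' f W x u) := by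
    intro W hW h V hV
    refine along_induction (I := I) (I' := I') (f := f) (x := x) (P := fun V =>
      ∀ u : TangentSpace I x, mvfderiv I (fun y => inner ℝ (V y) (W y)) x u
      = inner ℝ (covDerivAlong I I' f V x u) (W x)
        + inner ℝ (V x) (covDerivAlong I I' f W x u)) hf ?_ ?_ ?_ ?_ hV
    · intro V V' hVV' hV' u
      have h' : (fun y => inner ℝ (V y) (W y)) =ᶠ[nhds x] fun y => inner ℝ (V' y) (W y) := by
        filter_upwards [hVV'] with y hy
        rw [hy]
      rw [mvfderiv_congr h', covDerivAlong_congr hVV', hVV'.self_of_nhds, hV']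
    · intro u
      simp only [inner_zero_left, covDerivAlong_zero hf, zero_apply, add_zero]
      exact congrArg (fun L : TangentSpace I x →L[ℝ] ℝ => L u) (mvfderiv_const (I := I) (0 : ℝ))
    · intro V V' hV hV' ih ih' u
      simp only [inner_add_left]
      rw [mvfderiv_fun_add (mdifferentiableAt_inner_along hV hW)
        (mdifferentiableAt_inner_along hV' hW), covDerivAlong_add hf hV hV']
      simp only [add_apply, ih, ih', inner_add_left]
      ring
    · intro c Y hc hY u
      exact mvfderiv_inner_smul_comp hf hc hY hW (h Y hY) u
  refine aux W hW (fun Y hY => ?_) V hV u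
  have hYf : MDifferentiableAt I I'.tangent
      (fun y => (⟨f y, Y (f y)⟩ : TangentBundle I' M')) x :=
    (hY.mdifferentiable (by simp) (f x)).comp x hf
  have h1 := aux (fun y => Y (f y)) hYf ?_ W hW
  · intro u
    have h2 := h1 u
    have h3 : (fun y => inner ℝ (Y (f y)) (W y)) = fun y => inner ℝ (W y) (Y (f y)) :=
      funext fun y => real_inner_comm _ _
    rw [h3, h2, add_comm, real_inner_comm,
      real_inner_comm (Y (f x)) (covDerivAlong I I' f W x u)]
  · intro Z hZ u
    have hYd := hY.mdifferentiable (by simp) (f x)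
    have hZd := hZ.mdifferentiable (by simp) (f x)
    obtain ⟨X, hX, hXu⟩ := exists_smoothVectorField_apply_eq (I' := I') (mfderiv I I' f x u)
    have h2 := leviCivita_metric I' (hX.mdifferentiable (by simp) (f x)) hZd hYd
    rw [hXu] at h2
    rw [covDerivAlong_comp I I' f hf hYd, covDerivAlong_comp I I' f hf hZd]
    refine Eq.trans ?_ h2
    have h3 := mfderiv_comp x (g := fun y : M' => inner ℝ (Z y) (Y y))
      (mdifferentiableAt_inner I' hZd hYd) hf
    exact congrArg (fun L => L u) h3

end CovariantDerivativeAlong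

section TangentialPart

variable {E : Type*} [NormedAddCommGroup E] [NormedSpace ℝ E] [FiniteDimensional ℝ E]
  {H : Type*} [TopologicalSpace H] {I : ModelWithCorners ℝ E H}
  {M : Type*} [TopologicalSpace M] [ChartedSpace H M] [IsManifold I ∞ M]
  [RiemannianBundle (fun x : M => TangentSpace I x)]
  [IsContMDiffRiemannianBundle I ∞ E (fun x : M => TangentSpace I x)]
  {E' : Type*} [NormedAddCommGroup E'] [NormedSpace ℝ E'] [FiniteDimensional ℝ E']
  {H' : Type*} [TopologicalSpace H'] {I' : ModelWithCorners ℝ E' H'}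
  {M' : Type*} [TopologicalSpace M'] [ChartedSpace H' M'] [IsManifold I' ∞ M']
  [RiemannianBundle (fun x : M' => TangentSpace I' x)]
  [IsContMDiffRiemannianBundle I' ∞ E' (fun x : M' => TangentSpace I' x)]
  {J : Π x : M', TangentSpace I' x →L[ℝ] TangentSpace I' x}
  {f : M → M'} {x : M}

/-! ### Smoothness of tangential and normal parts -/

theorem mdifferentiableAt_mfderiv_apply (hf : ContMDiff I I' ∞ f) {Y : Π y : M, TangentSpace I y}
    (hY : MDifferentiableAt I I.tangent (fun y => (⟨y, Y y⟩ : TangentBundle I M)) x) :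
    MDifferentiableAt I I'.tangent
      (fun y => (⟨f y, mfderiv I I' f y (Y y)⟩ : TangentBundle I' M')) x := by
  refine MDifferentiableAt.clm_apply_of_inCoordinates (F₁ := E) (F₂ := E') (b₁ := id) (b₂ := f)
    (E₁ := fun y : M => TangentSpace I y) (E₂ := fun y : M' => TangentSpace I' y)
    (ϕ := fun y => mfderiv I I' f y) ?_ hY (hf.mdifferentiable (by simp) x)
  exact (ContMDiffAt.mfderiv_const (m := 1) (n := ∞) (hf x) (by norm_cast)).mdifferentiableAt
    one_ne_zero

theorem contMDiffAt_mfderiv_apply (hf : ContMDiff I I' ∞ f) {Y : Π y : M, TangentSpace I y}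
    (hY : ContMDiffAt I I.tangent ∞ (fun y => (⟨y, Y y⟩ : TangentBundle I M)) x) :
    ContMDiffAt I I'.tangent ∞
      (fun y => (⟨f y, mfderiv I I' f y (Y y)⟩ : TangentBundle I' M')) x := by
  refine ContMDiffAt.clm_apply_of_inCoordinates (F₁ := E) (F₂ := E') (b₁ := id) (b₂ := f)
    (E₁ := fun y : M => TangentSpace I y) (E₂ := fun y : M' => TangentSpace I' y)
    (ϕ := fun y => mfderiv I I' f y) ?_ hY (hf x)
  exact ContMDiffAt.mfderiv_const (m := ∞) (n := ∞) (hf x) (by simp)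

theorem contMDiffAt_inner {X Y : Π y : M, TangentSpace I y}
    (hX : ContMDiffAt I I.tangent ∞ (fun y => (⟨y, X y⟩ : TangentBundle I M)) x)
    (hY : ContMDiffAt I I.tangent ∞ (fun y => (⟨y, Y y⟩ : TangentBundle I M)) x) :
    ContMDiffAt I 𝓘(ℝ, ℝ) ∞ (fun y => inner ℝ (X y) (Y y)) x :=
  ContMDiffAt.inner_bundle (IB := I) (F := E) (E := fun y : M => TangentSpace I y)
    (b := fun y => y) hX hY

theorem contMDiffAt_gramSchmidt {k : ℕ} {s : Fin k → Π y : M, TangentSpace I y}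
    (hs : ∀ i, ContMDiffAt I I.tangent ∞ (fun y => (⟨y, s i y⟩ : TangentBundle I M)) x)
    (hli : LinearIndependent ℝ fun i => s i x) (i : Fin k) :
    ContMDiffAt I I.tangent ∞ (fun y => (⟨y, InnerProductSpace.gramSchmidt ℝ (fun j => s j y) i⟩ :
      TangentBundle I M)) x := by
  induction i using WellFoundedLT.induction with
  | ind i ih =>
    have h1 : ∀ j ∈ Finset.Iio i, ContMDiffAt I I.tangent ∞ (fun y => (⟨y,
        (inner ℝ (InnerProductSpace.gramSchmidt ℝ (fun j => s j y) j) (s i y)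
          / inner ℝ (InnerProductSpace.gramSchmidt ℝ (fun j => s j y) j)
            (InnerProductSpace.gramSchmidt ℝ (fun j => s j y) j)) •
          InnerProductSpace.gramSchmidt ℝ (fun j => s j y) j⟩ : TangentBundle I M)) x := by
      intro j hj
      have hj' := ih j (Finset.mem_Iio.1 hj)
      refine contMDiffAt_along_smul contMDiffAt_id ?_ hj'
      refine (contMDiffAt_inner hj' (hs i)).div₀ (contMDiffAt_inner hj' hj') ?_
      exact inner_self_ne_zero.2 (InnerProductSpace.gramSchmidt_ne_zero _ hli)
    have h2 := ContMDiffAt.sub_section (hs i) (ContMDiffAt.sum_section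
      (V := fun y : M => TangentSpace I y) h1)
    refine h2.congr_of_eventuallyEq (Filter.Eventually.of_forall fun y => ?_)
    simp only [Pi.sub_apply]
    rw [InnerProductSpace.gramSchmidt_def]
    congr 2
    refine Finset.sum_congr rfl fun j _ => ?_
    rw [Submodule.starProjection_singleton, real_inner_self_eq_norm_sq]
    rfl

/-- Near every point there is a smooth orthonormal frame. -/
theorem exists_orthonormal_frame (x : M) :
    ∃ g : Fin (Module.finrank ℝ E) → Π y : M, TangentSpace I y,
      (∀ i, ContMDiffAt I I.tangent ∞ (fun y => (⟨y, g i y⟩ : TangentBundle I M)) x) ∧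
      ∀ᶠ y in nhds x, ∀ t : TangentSpace I y, t = ∑ i, inner ℝ (g i y) t • g i y := by
  let e := trivializationAt E (fun z : M => TangentSpace I z) x
  let b := Module.finBasis ℝ E
  have hx : x ∈ e.baseSet := FiberBundle.mem_baseSet_trivializationAt' x
  have hfr := e.isLocalFrameOn_localFrame_baseSet I ∞ b
  refine ⟨fun i y => InnerProductSpace.gramSchmidtNormed ℝ (fun j => e.localFrame b j y) i,
    fun i => ?_, ?_⟩
  · have h1 := contMDiffAt_gramSchmidt (fun i => hfr.contMDiffAt e.open_baseSet hx i)
      (hfr.linearIndependent hx)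
    have hne : InnerProductSpace.gramSchmidt ℝ (fun j => e.localFrame b j x) i ≠ 0 :=
      InnerProductSpace.gramSchmidt_ne_zero _ (hfr.linearIndependent hx)
    refine contMDiffAt_along_smul contMDiffAt_id ?_ (h1 i)
    have h2 : ContMDiffAt I 𝓘(ℝ, ℝ) ∞ (fun y => √(inner ℝ
        (InnerProductSpace.gramSchmidt ℝ (fun j => e.localFrame b j y) i)
        (InnerProductSpace.gramSchmidt ℝ (fun j => e.localFrame b j y) i))) x :=
      (Real.contDiffAt_sqrt (inner_self_ne_zero.2 hne)).contMDiffAt.comp x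
        (contMDiffAt_inner (h1 i) (h1 i))
    refine (h2.inv₀ ?_).congr_of_eventuallyEq (Filter.Eventually.of_forall fun y => ?_)
    · rw [← norm_eq_sqrt_real_inner]
      exact norm_ne_zero_iff.2 hne
    · simp only [← norm_eq_sqrt_real_inner]
      rfl
  · filter_upwards [e.open_baseSet.mem_nhds hx] with y hy t
    have hon := InnerProductSpace.gramSchmidtNormed_orthonormal (𝕜 := ℝ) (hfr.linearIndependent hy)
    have hsp : ⊤ ≤ Submodule.span ℝ (Set.range
        (InnerProductSpace.gramSchmidtNormed ℝ fun j => e.localFrame b j y)) := by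
      rw [InnerProductSpace.span_gramSchmidtNormed_range, InnerProductSpace.span_gramSchmidt]
      exact hfr.generating hy
    have h := (OrthonormalBasis.mk hon hsp).sum_repr' t
    simpa only [OrthonormalBasis.coe_mk] using h.symm

theorem contMDiffAt_tangentPart (hf : ContMDiff I I' ∞ f) {W : Π y : M, TangentSpace I' (f y)}
    (hW : ContMDiffAt I I'.tangent ∞ (fun y => (⟨f y, W y⟩ : TangentBundle I' M')) x) :
    ContMDiffAt I I.tangent ∞
      (fun y => (⟨y, tangentPart I I' f y (W y)⟩ : TangentBundle I M)) x := by
  obtain ⟨g, hg, hgt⟩ := exists_orthonormal_frame (I := I) x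
  have h1 : ∀ i ∈ Finset.univ, ContMDiffAt I I.tangent ∞
      (fun y => (⟨y, inner ℝ (mfderiv I I' f y (g i y)) (W y) • g i y⟩ : TangentBundle I M)) x :=
    fun i _ => contMDiffAt_along_smul contMDiffAt_id
      (ContMDiffAt.inner_bundle (IB := I') (F := E') (E := fun z : M' => TangentSpace I' z)
        (b := f) (contMDiffAt_mfderiv_apply hf (hg i)) hW) (hg i)
  refine (ContMDiffAt.sum_section (V := fun y : M => TangentSpace I y) h1).congr_of_eventuallyEq ?_
  filter_upwards [hgt] with y hy
  congr 1
  refine (hy _).trans (Finset.sum_congr rfl fun i _ => ?_)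
  have : CompleteSpace (TangentSpace I y) := FiniteDimensional.complete ℝ _
  have : CompleteSpace (TangentSpace I' (f y)) := FiniteDimensional.complete ℝ _
  rw [tangentPart, ContinuousLinearMap.adjoint_inner_right]

theorem contMDiffAt_normalPart (hf : ContMDiff I I' ∞ f) {W : Π y : M, TangentSpace I' (f y)}
    (hW : ContMDiffAt I I'.tangent ∞ (fun y => (⟨f y, W y⟩ : TangentBundle I' M')) x) :
    ContMDiffAt I I'.tangent ∞
      (fun y => (⟨f y, normalPart I I' f y (W y)⟩ : TangentBundle I' M')) x := by
  have h1 := contMDiffAt_mfderiv_apply hf (contMDiffAt_tangentPart hf hW)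
  have h2 := contMDiffAt_along_add (hf x) hW
    (contMDiffAt_along_smul (hf x) (c := fun _ => -1) contMDiffAt_const h1)
  refine h2.congr_of_eventuallyEq (Filter.Eventually.of_forall fun y => ?_)
  simp only [normalPart, sub_apply, ContinuousLinearMap.comp_apply, ContinuousLinearMap.id_apply]
  rw [neg_one_smul, sub_eq_add_neg]

theorem tangentPart_eq_zero {v : TangentSpace I' (f x)}
    (hv : ∀ u : TangentSpace I x, inner ℝ (mfderiv I I' f x u) v = 0) :
    tangentPart I I' f x v = 0 := by
  have : CompleteSpace (TangentSpace I x) := FiniteDimensional.complete ℝ _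
  have : CompleteSpace (TangentSpace I' (f x)) := FiniteDimensional.complete ℝ _
  refine ext_inner_left ℝ fun u => ?_
  rw [tangentPart, ContinuousLinearMap.adjoint_inner_right, hv, inner_zero_right]

theorem normalPart_eq_self {v : TangentSpace I' (f x)}
    (hv : ∀ u : TangentSpace I x, inner ℝ (mfderiv I I' f x u) v = 0) :
    normalPart I I' f x v = v := by
  simp only [normalPart, sub_apply, ContinuousLinearMap.comp_apply, ContinuousLinearMap.id_apply,
    tangentPart_eq_zero hv, map_zero, sub_zero]

theorem exists_smoothNormalField_apply_eq [T2Space M'] (hf : IsIsometricImmersion I I' f)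
    {v : TangentSpace I' (f x)} (hv : ∀ u : TangentSpace I x, inner ℝ (mfderiv I I' f x u) v = 0) :
    ∃ V : Π y : M, TangentSpace I' (f y), IsSmoothNormalField I I' f V ∧ V x = v := by
  obtain ⟨Z, hZ, rfl⟩ := exists_smoothVectorField_apply_eq (I' := I') v
  refine ⟨fun y => normalPart I I' f y (Z (f y)),
    ⟨fun y => contMDiffAt_normalPart hf.contMDiff ((hZ.comp hf.contMDiff) y),
      fun y u => inner_normalPart I I' f hf y _ u⟩, ?_⟩
  exact normalPart_eq_self hv

end TangentialPart

section SecondFundamentalForm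

variable {E : Type*} [NormedAddCommGroup E] [NormedSpace ℝ E] [FiniteDimensional ℝ E]
  {H : Type*} [TopologicalSpace H] {I : ModelWithCorners ℝ E H}
  {M : Type*} [TopologicalSpace M] [ChartedSpace H M] [IsManifold I ∞ M]
  [RiemannianBundle (fun x : M => TangentSpace I x)]
  [IsContMDiffRiemannianBundle I ∞ E (fun x : M => TangentSpace I x)]
  {E' : Type*} [NormedAddCommGroup E'] [NormedSpace ℝ E'] [FiniteDimensional ℝ E']
  {H' : Type*} [TopologicalSpace H'] {I' : ModelWithCorners ℝ E' H'}
  {M' : Type*} [TopologicalSpace M'] [ChartedSpace H' M'] [IsManifold I' ∞ M']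
  [RiemannianBundle (fun x : M' => TangentSpace I' x)]
  [IsContMDiffRiemannianBundle I' ∞ E' (fun x : M' => TangentSpace I' x)]
  {J : Π x : M', TangentSpace I' x →L[ℝ] TangentSpace I' x}
  {f : M → M'} {x : M}

/-! ### The second fundamental form -/

theorem mlieBracket_extend {z : M'} (a b : TangentSpace I' z) :
    mlieBracket I' (FiberBundle.extend E' a) (FiberBundle.extend E' b) z = 0 := by
  have key : ∀ a : TangentSpace I' z, mpullbackWithin 𝓘(ℝ, E') I' (extChartAt I' z).symm
      (FiberBundle.extend E' a) (Set.range I') =ᶠ[nhdsWithin (extChartAt I' z z) (Set.range I')]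
        fun _ => ((trivializationAt E' (fun z : M' => TangentSpace I' z) z) ⟨z, a⟩).2 := by
    intro a
    filter_upwards [extChartAt_target_mem_nhdsWithin (I := I') z] with p hp
    have hy : (extChartAt I' z).symm p ∈ (chartAt H' z).source := by
      simpa only [extChartAt_source] using (extChartAt I' z).map_target hp
    have h1 := TangentBundle.symmL_trivializationAt (I := I') hy
    rw [(extChartAt I' z).right_inv hp] at h1
    have hy' : (extChartAt I' z).symm p ∈
        (trivializationAt E' (fun z : M' => TangentSpace I' z) z).baseSet := hy
    rw [mpullbackWithin_apply, ← h1]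
    have h2 : FiberBundle.extend E' a ((extChartAt I' z).symm p)
        = (trivializationAt E' (fun z : M' => TangentSpace I' z) z).symmL ℝ
          ((extChartAt I' z).symm p)
          ((trivializationAt E' (fun z : M' => TangentSpace I' z) z) ⟨z, a⟩).2 :=
      (Trivialization.symmL_apply _ hy' _).symm
    rw [h2]
    have hinv := isInvertible_mfderivWithin_extChartAt_symm (I := I') hp
    rw [← h1] at hinv
    exact hinv.inverse_apply_eq.2 rfl
  have hz : extChartAt I' z z ∈ Set.range I' := Set.mem_range_self _
  rw [← mlieBracketWithin_univ, mlieBracketWithin_apply]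
  simp only [Set.preimage_univ, Set.univ_inter]
  rw [Filter.EventuallyEq.lieBracketWithin_vectorField_eq_of_mem (key a) (key b) hz]
  have h0 : lieBracketWithin ℝ
      (fun _ => ((trivializationAt E' (fun z : M' => TangentSpace I' z) z) ⟨z, a⟩).2)
      (fun _ => ((trivializationAt E' (fun z : M' => TangentSpace I' z) z) ⟨z, b⟩).2)
      (Set.range I') (extChartAt I' z z) = 0 := by
    simp [lieBracketWithin]
  rw [h0]
  exact map_zero _

theorem leviCivita_extend_symm {z : M'} (a b : TangentSpace I' z) :
    leviCivita I' (FiberBundle.extend E' b) z a = leviCivita I' (FiberBundle.extend E' a) z b := by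
  have h := leviCivita_torsion_free I' (FiberBundle.mdifferentiableAt_extend I' E' a)
    (FiberBundle.mdifferentiableAt_extend I' E' b)
  rw [mlieBracket_extend, FiberBundle.extend_apply_self, FiberBundle.extend_apply_self] at h
  exact sub_eq_zero.1 h

theorem tensorialAt_mfderiv (hf : ContMDiff I I' ∞ f) (x : M) :
    TensorialAt I E (fun Y : Π y : M, TangentSpace I y =>
      covDerivAlong I I' f (fun y => mfderiv I I' f y (Y y)) x
        - mfderiv I I' f x ∘L leviCivita I Y x) x where
  smul {c Y} hc hY := by
    have hfx := hf.mdifferentiable (by simp) x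
    have h1 := covDerivAlong_smul (V := fun y => mfderiv I I' f y (Y y)) hfx hc
      (mdifferentiableAt_mfderiv_apply hf hY)
    simp only [Pi.smul_apply', map_smul]
    rw [h1, (leviCivita I).isCovariantDerivativeOnUniv.leibniz hY hc]
    ext u
    simp only [sub_apply, add_apply, smul_apply, ContinuousLinearMap.comp_apply,
      ContinuousLinearMap.smulRight_apply, map_add, map_smul, smul_sub]
    abel
  add {Y Y'} hY hY' := by
    have hfx := hf.mdifferentiable (by simp) x
    have h1 := covDerivAlong_add hfx (mdifferentiableAt_mfderiv_apply hf hY)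
      (mdifferentiableAt_mfderiv_apply hf hY')
    simp only [Pi.add_apply, map_add]
    rw [h1, (leviCivita I).isCovariantDerivativeOnUniv.add hY hY']
    ext u
    simp only [sub_apply, add_apply, ContinuousLinearMap.comp_apply, map_add]
    abel

/-- The second fundamental form `h(u, Y) = ∇'_u Y - ∇_u Y` of an immersion, with the arguments in
the order `secondFundamentalForm hf x (Y x) u`. -/
noncomputable def secondFundamentalForm (hf : ContMDiff I I' ∞ f) (x : M) :
    TangentSpace I x →L[ℝ] TangentSpace I x →L[ℝ] TangentSpace I' (f x) :=
  (tensorialAt_mfderiv hf x).mkHom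

/-- Gauss' formula. -/
theorem covDerivAlong_mfderiv (hf : ContMDiff I I' ∞ f) {Y : Π y : M, TangentSpace I y}
    (hY : MDifferentiableAt I I.tangent (fun y => (⟨y, Y y⟩ : TangentBundle I M)) x)
    (u : TangentSpace I x) :
    covDerivAlong I I' f (fun y => mfderiv I I' f y (Y y)) x u
      = mfderiv I I' f x (leviCivita I Y x u) + secondFundamentalForm hf x (Y x) u := by
  have h := TensorialAt.mkHom_apply (tensorialAt_mfderiv hf x) hY
  rw [secondFundamentalForm, h]
  simp

theorem contDiffAt_writtenInExtChartAt [I.Boundaryless] (hf : ContMDiff I I' ∞ f) (x : M) :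
    ContDiffAt ℝ ∞ (extChartAt I' (f x) ∘ f ∘ (extChartAt I x).symm) (extChartAt I x x) := by
  have h := (contMDiffAt_iff.1 (hf x)).2
  rwa [I.range_eq_univ, contDiffWithinAt_univ] at h

theorem mvfderiv_mfderiv_extend [I.Boundaryless] (hf : ContMDiff I I' ∞ f)
    (a b : TangentSpace I x) :
    mvfderiv I (fun y => ((trivializationAt E' (fun z : M' => TangentSpace I' z) (f x))
        ⟨f y, mfderiv I I' f y (FiberBundle.extend E b y)⟩).2) x a
      = fderiv ℝ (fderiv ℝ (extChartAt I' (f x) ∘ f ∘ (extChartAt I x).symm)) (extChartAt I x x)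
          (mvfderiv I (extChartAt I x) x a)
          (mvfderiv I (extChartAt I x) x b) := by
  let e' := trivializationAt E' (fun z : M' => TangentSpace I' z) (f x)
  let e := trivializationAt E (fun z : M => TangentSpace I z) x
  let F := extChartAt I' (f x) ∘ f ∘ (extChartAt I x).symm
  let c : E := mvfderiv I (extChartAt I x) x b
  have hF : ContDiffAt ℝ ∞ F (extChartAt I x x) := contDiffAt_writtenInExtChartAt hf x
  have h1 : (fun y => (e' ⟨f y, mfderiv I I' f y (FiberBundle.extend E b y)⟩).2) =ᶠ[nhds x]
      (fun p => fderiv ℝ F p c) ∘ extChartAt I x := by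
    filter_upwards [(chartAt H x).open_source.mem_nhds (mem_chart_source H x),
      hf.continuous.continuousAt.preimage_mem_nhds
        ((chartAt H' (f x)).open_source.mem_nhds (mem_chart_source H' (f x)))] with y hy hfy
    have hsy : y ∈ (extChartAt I x).source := by rwa [extChartAt_source]
    have hc : (e ⟨x, b⟩).2 = c := by
      have h := TangentBundle.continuousLinearMapAt_trivializationAt (I := I) (mem_chart_source H x)
      have h' := congrArg (fun L : E →L[ℝ] E => L b) h
      refine Eq.trans ?_ h'
      exact (congrFun (e.coe_linearMapAt_of_mem (R := ℝ)
        (FiberBundle.mem_baseSet_trivializationAt' x)) b).symm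
    have hext : FiberBundle.extend E b y
        = mfderivWithin 𝓘(ℝ, E) I (extChartAt I x).symm (Set.range I) (extChartAt I x y) c := by
      rw [← TangentBundle.symmL_trivializationAt hy, ← hc]
      exact (Trivialization.symmL_apply e hy _).symm
    have he' : ∀ w : TangentSpace I' (f y), (e' ⟨f y, w⟩).2
        = mfderiv I' 𝓘(ℝ, E') (extChartAt I' (f x)) (f y) w := by
      intro w
      rw [← TangentBundle.continuousLinearMapAt_trivializationAt hfy]
      exact (congrFun (e'.coe_linearMapAt_of_mem (R := ℝ) hfy) w).symm
    rw [he', hext, I.range_eq_univ, mfderivWithin_univ]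
    have hs1 : MDifferentiableAt 𝓘(ℝ, E) I (extChartAt I x).symm (extChartAt I x y) := by
      have h := mdifferentiableWithinAt_extChartAt_symm (I := I)
        ((extChartAt I x).map_source hsy)
      rwa [I.range_eq_univ, mdifferentiableWithinAt_univ] at h
    have hyy : (extChartAt I x).symm (extChartAt I x y) = y := (extChartAt I x).left_inv hsy
    have hs2 : HasMFDerivAt I 𝓘(ℝ, E') (extChartAt I' (f x) ∘ f)
        ((extChartAt I x).symm (extChartAt I x y))
        (mfderiv I' 𝓘(ℝ, E') (extChartAt I' (f x)) (f y) ∘L mfderiv I I' f y) := by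
      rw [hyy]
      exact (mdifferentiableAt_extChartAt hfy).hasMFDerivAt.comp y
        (hf.mdifferentiable (by simp) y).hasMFDerivAt
    have hs3 := (hs2.comp (extChartAt I x y) hs1.hasMFDerivAt).mfderiv
    have hs4 : mfderiv 𝓘(ℝ, E) 𝓘(ℝ, E') F (extChartAt I x y) = fderiv ℝ F (extChartAt I x y) :=
      mfderiv_eq_fderiv
    exact (congrArg (fun L : E →L[ℝ] E' => L c) hs3).symm.trans
      (congrArg (fun L : E →L[ℝ] E' => L c) hs4)
  have hF2 : DifferentiableAt ℝ (fderiv ℝ F) (extChartAt I x x) :=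
    (hF.fderiv_right (m := 1) (by norm_cast)).differentiableAt one_ne_zero
  have hG : DifferentiableAt ℝ (fun p => fderiv ℝ F p c) (extChartAt I x x) :=
    hF2.clm_apply (differentiableAt_const c)
  rw [mvfderiv_congr h1]
  refine Eq.trans (b := mvfderiv 𝓘(ℝ, E) (fun p => fderiv ℝ F p c) (extChartAt I x x)
    (mvfderiv I (extChartAt I x) x a)) (mfderiv_comp_apply x hG.mdifferentiableAt
      (mdifferentiableAt_extChartAt (I := I) (mem_chart_source H x)) a) ?_
  have h2 : mvfderiv 𝓘(ℝ, E) (fun p => fderiv ℝ F p c) (extChartAt I x x)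
      = fderiv ℝ (fun p => fderiv ℝ F p c) (extChartAt I x x) := by
    ext v
    exact congrArg (fun L : E →L[ℝ] E' => L v) mfderiv_eq_fderiv
  have h3 : fderiv ℝ (fun p => fderiv ℝ F p c) (extChartAt I x x)
      = (fderiv ℝ (fderiv ℝ F) (extChartAt I x x)).flip c := by
    rw [fderiv_clm_apply hF2 (differentiableAt_const c)]
    simp
  rw [h2, h3]
  rfl

theorem secondFundamentalForm_symm [I.Boundaryless] (hf : ContMDiff I I' ∞ f)
    (a b : TangentSpace I x) :
    secondFundamentalForm hf x a b = secondFundamentalForm hf x b a := by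
  have h1 : ∀ a b : TangentSpace I x, secondFundamentalForm hf x b a
      = (trivializationAt E' (fun z : M' => TangentSpace I' z) (f x)).symmL ℝ (f x)
          (fderiv ℝ (fderiv ℝ (extChartAt I' (f x) ∘ f ∘ (extChartAt I x).symm))
            (extChartAt I x x)
            (mvfderiv I (extChartAt I x) x a) (mvfderiv I (extChartAt I x) x b))
        + leviCivita I' (FiberBundle.extend E' (mfderiv I I' f x b)) (f x) (mfderiv I I' f x a)
        - mfderiv I I' f x (leviCivita I (FiberBundle.extend E b) x a) := by
    intro a b
    have h := covDerivAlong_mfderiv hf (FiberBundle.mdifferentiableAt_extend I E b) a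
    rw [FiberBundle.extend_apply_self, add_comm] at h
    rw [← sub_eq_iff_eq_add.2 h, ← mvfderiv_mfderiv_extend hf a b]
    simp [covDerivAlong]
  have hsymm := (contDiffAt_writtenInExtChartAt hf x).isSymmSndFDerivAt
    (by simpa using (by norm_cast : (2 : WithTop ℕ∞) ≤ ∞))
  rw [h1 a b, h1 b a, leviCivita_extend_symm a b,
    hsymm (mvfderiv I (extChartAt I x) x a) (mvfderiv I (extChartAt I x) x b),
    leviCivita_extend_symm (mfderiv I I' f x a)]

variable [T2Space M']

/-- The second fundamental form is normal to the submanifold. -/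
theorem inner_secondFundamentalForm [I.Boundaryless] (hf : IsIsometricImmersion I I' f)
    (a b c : TangentSpace I x) :
    inner ℝ (mfderiv I I' f x c) (secondFundamentalForm hf.contMDiff x a b) = 0 := by
  let B := secondFundamentalForm hf.contMDiff x
  have hanti : ∀ a b c : TangentSpace I x,
      inner ℝ (B a b) (mfderiv I I' f x c) + inner ℝ (mfderiv I I' f x a) (B c b) = 0 := by
    intro a b c
    have ha := FiberBundle.mdifferentiableAt_extend I E a
    have hb := FiberBundle.mdifferentiableAt_extend I E b
    have hc := FiberBundle.mdifferentiableAt_extend I E c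
    have h1 := mvfderiv_inner_along (hf.contMDiff.mdifferentiable (by simp) x)
      (mdifferentiableAt_mfderiv_apply hf.contMDiff ha)
      (mdifferentiableAt_mfderiv_apply hf.contMDiff hc) b
    have h2 := leviCivita_metric I hb ha hc
    simp only [hf.inner_mfderiv] at h1
    rw [covDerivAlong_mfderiv hf.contMDiff ha, covDerivAlong_mfderiv hf.contMDiff hc] at h1
    simp only [FiberBundle.extend_apply_self, inner_add_left, inner_add_right,
      hf.inner_mfderiv] at h1 h2
    change mvfderiv I (fun y => inner ℝ (FiberBundle.extend E a y : TangentSpace I y)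
      (FiberBundle.extend E c y)) x b = _ at h2
    rw [h2] at h1
    linarith
  have hsymm : ∀ a b : TangentSpace I x, B a b = B b a :=
    secondFundamentalForm_symm hf.contMDiff
  have h1 := hanti a b c
  have h2 := hanti b c a
  have h3 := hanti c a b
  rw [hsymm c b] at h1
  rw [hsymm a c] at h2
  rw [hsymm b a] at h3
  rw [real_inner_comm] at h1 h2 h3
  change inner ℝ (mfderiv I I' f x c) (B a b) = 0
  linarith

end SecondFundamentalForm

section ShapeOperator

variable {E : Type*} [NormedAddCommGroup E] [NormedSpace ℝ E] [FiniteDimensional ℝ E]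
  {H : Type*} [TopologicalSpace H] {I : ModelWithCorners ℝ E H}
  {M : Type*} [TopologicalSpace M] [ChartedSpace H M] [IsManifold I ∞ M]
  [RiemannianBundle (fun x : M => TangentSpace I x)]
  [IsContMDiffRiemannianBundle I ∞ E (fun x : M => TangentSpace I x)]
  {E' : Type*} [NormedAddCommGroup E'] [NormedSpace ℝ E'] [FiniteDimensional ℝ E']
  {H' : Type*} [TopologicalSpace H'] {I' : ModelWithCorners ℝ E' H'}
  {M' : Type*} [TopologicalSpace M'] [ChartedSpace H' M'] [IsManifold I' ∞ M']
  [RiemannianBundle (fun x : M' => TangentSpace I' x)]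
  [IsContMDiffRiemannianBundle I' ∞ E' (fun x : M' => TangentSpace I' x)]
  {J : Π x : M', TangentSpace I' x →L[ℝ] TangentSpace I' x}
  {f : M → M'} {x : M}

/-! ### The shape operator and the covariant derivative of `N` -/

theorem normalPart_mfderiv (hf : IsIsometricImmersion I I' f) (u : TangentSpace I x) :
    normalPart I I' f x (mfderiv I I' f x u) = 0 := by
  simp only [normalPart, sub_apply, ContinuousLinearMap.comp_apply, ContinuousLinearMap.id_apply,
    tangentPart_mfderiv I I' f hf, sub_self]

theorem inner_normalPart_right {v : TangentSpace I' (f x)}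
    (hv : ∀ u : TangentSpace I x, inner ℝ (mfderiv I I' f x u) v = 0)
    (w : TangentSpace I' (f x)) :
    inner ℝ v (normalPart I I' f x w) = inner ℝ v w := by
  simp only [normalPart, sub_apply, ContinuousLinearMap.comp_apply, ContinuousLinearMap.id_apply,
    inner_sub_right]
  rw [real_inner_comm _ v, real_inner_comm _ v, hv, sub_zero]

theorem inner_tangentPart (w : TangentSpace I' (f x)) (u : TangentSpace I x) :
    inner ℝ (tangentPart I I' f x w) u = inner ℝ w (mfderiv I I' f x u) := by
  have : CompleteSpace (TangentSpace I x) := FiniteDimensional.complete ℝ _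
  have : CompleteSpace (TangentSpace I' (f x)) := FiniteDimensional.complete ℝ _
  rw [tangentPart, ContinuousLinearMap.adjoint_inner_left]

theorem inner_opT {p q : ℕ} (hJ : IsMetallicRiemannian I' p q J) (u w : TangentSpace I x) :
    inner ℝ (opT I I' J f x u) w = inner ℝ u (opT I I' J f x w) := by
  simp only [opT, ContinuousLinearMap.comp_apply]
  rw [inner_tangentPart, real_inner_comm _ u, inner_tangentPart, hJ.symm, real_inner_comm]

theorem contMDiffAt_apply_along {p q : ℕ} (hJ : IsMetallicRiemannian I' p q J)
    {V : Π y : M, TangentSpace I' (f y)}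
    (hf : ContMDiffAt I I' ∞ f x)
    (hV : ContMDiffAt I I'.tangent ∞ (fun y => (⟨f y, V y⟩ : TangentBundle I' M')) x) :
    ContMDiffAt I I'.tangent ∞ (fun y => (⟨f y, J (f y) (V y)⟩ : TangentBundle I' M')) x :=
  ContMDiffAt.clm_bundle_apply (F₁ := E') (F₂ := E') (E₁ := fun y : M' => TangentSpace I' y)
    (E₂ := fun y : M' => TangentSpace I' y) (b := f) (ϕ := fun y => J (f y))
    ((hJ.smooth (f x)).comp x hf) hV

theorem isSmoothNormalField_opn {p q : ℕ} (hJ : IsMetallicRiemannian I' p q J)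
    (hf : IsIsometricImmersion I I' f) {V : Π y : M, TangentSpace I' (f y)}
    (hV : IsSmoothNormalField I I' f V) :
    IsSmoothNormalField I I' f fun y => opn I I' J f y (V y) :=
  ⟨fun y => contMDiffAt_normalPart hf.contMDiff
      (contMDiffAt_apply_along hJ (hf.contMDiff y) (hV.1 y)),
    fun y u => inner_normalPart I I' f hf y _ u⟩

variable [T2Space M']

theorem inner_shapeOperator [I.Boundaryless] (hf : IsIsometricImmersion I I' f)
    {V : Π y : M, TangentSpace I' (f y)} (hV : IsSmoothNormalField I I' f V)
    (u c : TangentSpace I x) :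
    inner ℝ (shapeOperator I I' f V x u) c
      = inner ℝ (V x) (secondFundamentalForm hf.contMDiff x c u) := by
  have hc := FiberBundle.mdifferentiableAt_extend I E c
  have h := mvfderiv_inner_along (hf.contMDiff.mdifferentiable (by simp) x)
    (hV.1.mdifferentiable (by simp) x) (mdifferentiableAt_mfderiv_apply hf.contMDiff hc) u
  have h0 : (fun y => inner ℝ (V y) (mfderiv I I' f y (FiberBundle.extend E c y)))
      = fun _ => (0 : ℝ) := by
    funext y
    rw [real_inner_comm, hV.2]
  have h1 : mvfderiv I (fun _ : M => (0 : ℝ)) x u = 0 :=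
    congrArg (fun L : TangentSpace I x →L[ℝ] ℝ => L u) (mvfderiv_const (I := I) (0 : ℝ))
  rw [h0, h1, covDerivAlong_mfderiv hf.contMDiff hc, FiberBundle.extend_apply_self,
    inner_add_right, real_inner_comm _ (V x), hV.2, zero_add] at h
  simp only [shapeOperator, neg_apply, ContinuousLinearMap.comp_apply, inner_neg_left]
  rw [inner_tangentPart]
  linarith

theorem inner_shapeOperator_opn [I.Boundaryless] {p q : ℕ} (hJ : IsMetallicRiemannian I' p q J)
    (hf : IsIsometricImmersion I I' f)
    {V : Π y : M, TangentSpace I' (f y)} (hV : IsSmoothNormalField I I' f V)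
    (u c : TangentSpace I x) :
    inner ℝ (shapeOperator I I' f (fun y => opn I I' J f y (V y)) x u) c
      = inner ℝ (V x) (opn I I' J f x (secondFundamentalForm hf.contMDiff x c u)) := by
  rw [inner_shapeOperator hf (isSmoothNormalField_opn hJ hf hV)]
  simp only [opn, ContinuousLinearMap.comp_apply]
  rw [real_inner_comm, inner_normalPart_right (fun w => inner_secondFundamentalForm hf c u w),
    inner_normalPart_right (hV.2 x), ← hJ.symm, real_inner_comm]

theorem inner_opT_shapeOperator [I.Boundaryless] {p q : ℕ} (hJ : IsMetallicRiemannian I' p q J)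
    (hf : IsIsometricImmersion I I' f)
    {V : Π y : M, TangentSpace I' (f y)} (hV : IsSmoothNormalField I I' f V)
    (u c : TangentSpace I x) :
    inner ℝ (opT I I' J f x (shapeOperator I I' f V x u)) c
      = inner ℝ (V x) (secondFundamentalForm hf.contMDiff x (opT I I' J f x c) u) := by
  rw [inner_opT hJ, inner_shapeOperator hf hV]

/-- `(∇'_u N) Y = n h(u, Y) - h(u, TY)`. -/
theorem covDerivN_eq [I.Boundaryless] {p q : ℕ} (hJ : IsLocallyMetallicRiemannian I' p q J)
    (hf : IsIsometricImmersion I I' f) {Y : Π y : M, TangentSpace I y}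
    (hY : IsSmoothVectorField I Y) (u : TangentSpace I x) :
    covDerivN I I' J f Y x u
      = opn I I' J f x (secondFundamentalForm hf.contMDiff x (Y x) u)
        - secondFundamentalForm hf.contMDiff x (opT I I' J f x (Y x)) u := by
  have hfx := hf.contMDiff.mdifferentiable (by simp) x
  have hYx := hY.mdifferentiable (by simp) x
  have hdY := mdifferentiableAt_mfderiv_apply hf.contMDiff hYx
  have hTY : MDifferentiableAt I I.tangent
      (fun y => (⟨y, opT I I' J f y (Y y)⟩ : TangentBundle I M)) x :=
    (contMDiffAt_tangentPart hf.contMDiff (contMDiffAt_apply_along hJ.toIsMetallicRiemannian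
      (hf.contMDiff x) (contMDiffAt_mfderiv_apply hf.contMDiff (hY x)))).mdifferentiableAt
      (by simp)
  obtain ⟨hJY, hpar⟩ := covDerivAlong_parallel hJ hfx hdY
  have hdTY := mdifferentiableAt_mfderiv_apply hf.contMDiff hTY
  have hc : MDifferentiableAt I 𝓘(ℝ, ℝ) (fun _ : M => (-1 : ℝ)) x := mdifferentiableAt_const
  have hN : (fun y => opN I I' J f y (Y y)) = fun y => J (f y) (mfderiv I I' f y (Y y))
      + (fun _ : M => (-1 : ℝ)) y • mfderiv I I' f y (opT I I' J f y (Y y)) := by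
    funext y
    simp only [opN, opT, normalPart, sub_apply, ContinuousLinearMap.comp_apply,
      ContinuousLinearMap.id_apply]
    rw [neg_one_smul, sub_eq_add_neg]
  have h1 : covDerivAlong I I' f (fun y => opN I I' J f y (Y y)) x u
      = J (f x) (mfderiv I I' f x (leviCivita I Y x u))
        + J (f x) (secondFundamentalForm hf.contMDiff x (Y x) u)
        - (mfderiv I I' f x (leviCivita I (fun y => opT I I' J f y (Y y)) x u)
          + secondFundamentalForm hf.contMDiff x (opT I I' J f x (Y x)) u) := by
    rw [hN, covDerivAlong_add hfx hJY (mdifferentiableAt_along_smul hfx hc hdTY),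
      covDerivAlong_smul hfx hc hdTY, hpar]
    have h2 : mvfderiv I (fun _ : M => (-1 : ℝ)) x = 0 := mvfderiv_const (I := I) (-1 : ℝ)
    rw [h2]
    simp only [add_apply, smul_apply, ContinuousLinearMap.comp_apply,
      ContinuousLinearMap.smulRight_apply, zero_apply, zero_smul, add_zero]
    rw [covDerivAlong_mfderiv hf.contMDiff hYx, covDerivAlong_mfderiv hf.contMDiff hTY, map_add,
      neg_one_smul, sub_eq_add_neg]
  simp only [covDerivN, normalConnection, sub_apply, ContinuousLinearMap.comp_apply]
  rw [h1]
  simp only [map_sub, map_add, normalPart_mfderiv hf, ContinuousLinearMap.comp_apply,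
    normalPart_eq_self (fun w => inner_secondFundamentalForm hf _ u w), opN, opn]
  abel

end ShapeOperator

end MetallicGeometry

theorem mainTheorem8 {d m : ℕ}
    -- the ambient locally metallic Riemannian manifold
    {M' : Type*} [TopologicalSpace M'] [T2Space M'] [SecondCountableTopology M']
    [ChartedSpace (EuclideanSpace ℝ (Fin m)) M'] [IsManifold (𝓡 m) ∞ M']
    [RiemannianBundle (fun x : M' => TangentSpace (𝓡 m) x)]
    [IsContMDiffRiemannianBundle (𝓡 m) ∞ (EuclideanSpace ℝ (Fin m))
      (fun x : M' => TangentSpace (𝓡 m) x)]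
    (p q : ℕ) (J : Π x : M', TangentSpace (𝓡 m) x →L[ℝ] TangentSpace (𝓡 m) x)
    (hJ : IsLocallyMetallicRiemannian (𝓡 m) p q J)
    -- the isometrically immersed submanifold
    {M : Type*} [TopologicalSpace M] [T2Space M] [SecondCountableTopology M]
    [ChartedSpace (EuclideanSpace ℝ (Fin d)) M] [IsManifold (𝓡 d) ∞ M]
    [RiemannianBundle (fun x : M => TangentSpace (𝓡 d) x)]
    [IsContMDiffRiemannianBundle (𝓡 d) ∞ (EuclideanSpace ℝ (Fin d))
      (fun x : M => TangentSpace (𝓡 d) x)]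
    (f : M → M') (hf : IsIsometricImmersion (𝓡 d) (𝓡 m) f)
    (hM : IsSemiSlantSubmanifold (𝓡 d) (𝓡 m) J f) :
    IsParallelN (𝓡 d) (𝓡 m) J f ↔
      ∀ (X : Π x : M, TangentSpace (𝓡 d) x) (V : Π x : M, TangentSpace (𝓡 m) (f x)),
        IsSmoothVectorField (𝓡 d) X → IsSmoothNormalField (𝓡 d) (𝓡 m) f V → ∀ x : M,
          shapeOperator (𝓡 d) (𝓡 m) f (fun y => opn (𝓡 d) (𝓡 m) J f y (V y)) x (X x)
              = opT (𝓡 d) (𝓡 m) J f x (shapeOperator (𝓡 d) (𝓡 m) f V x (X x)) ∧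
            opT (𝓡 d) (𝓡 m) J f x (shapeOperator (𝓡 d) (𝓡 m) f V x (X x))
              = shapeOperator (𝓡 d) (𝓡 m) f V x (opT (𝓡 d) (𝓡 m) J f x (X x)) := by
  constructor
  · intro hN X V _ hV x
    have hB : ∀ a u : TangentSpace (𝓡 d) x,
        opn (𝓡 d) (𝓡 m) J f x (secondFundamentalForm hf.contMDiff x a u)
          = secondFundamentalForm hf.contMDiff x (opT (𝓡 d) (𝓡 m) J f x a) u := by
      intro a u
      obtain ⟨Y, hY, rfl⟩ := exists_smoothVectorField_apply_eq (I' := 𝓡 d) a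
      obtain ⟨U, hU, rfl⟩ := exists_smoothVectorField_apply_eq (I' := 𝓡 d) u
      rw [← sub_eq_zero, ← covDerivN_eq hJ hf hY]
      exact hN U Y hU hY x
    constructor
    · refine ext_inner_right ℝ fun c => ?_
      rw [inner_shapeOperator_opn hJ.toIsMetallicRiemannian hf hV, hB,
        inner_opT_shapeOperator hJ.toIsMetallicRiemannian hf hV]
    · refine ext_inner_right ℝ fun c => ?_
      rw [inner_opT_shapeOperator hJ.toIsMetallicRiemannian hf hV, inner_shapeOperator hf hV,
        secondFundamentalForm_symm hf.contMDiff c, ← hB, ← hB,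
        secondFundamentalForm_symm hf.contMDiff c]
  · intro h X Y hX hY x
    rw [covDerivN_eq hJ hf hY]
    have hw : ∀ u : TangentSpace (𝓡 d) x, inner ℝ (mfderiv (𝓡 d) (𝓡 m) f x u)
        (opn (𝓡 d) (𝓡 m) J f x (secondFundamentalForm hf.contMDiff x (Y x) (X x))
          - secondFundamentalForm hf.contMDiff x (opT (𝓡 d) (𝓡 m) J f x (Y x)) (X x)) = 0 := by
      intro u
      rw [inner_sub_right, inner_secondFundamentalForm hf, sub_zero]
      exact inner_normalPart (𝓡 d) (𝓡 m) f hf x _ u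
    obtain ⟨V, hV, hVx⟩ := exists_smoothNormalField_apply_eq hf hw
    have h1 := congrArg (fun v => inner ℝ v (Y x)) (h X V hX hV x).1
    rw [inner_shapeOperator_opn hJ.toIsMetallicRiemannian hf hV,
      inner_opT_shapeOperator hJ.toIsMetallicRiemannian hf hV, ← sub_eq_zero,
      ← inner_sub_right, hVx] at h1
    exact inner_self_eq_zero.1 h1
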